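/- Let $n\ge 1$. There is a constant $\tilde C_n>0$, depending only on $n$, with the following property. Let $\psi:\mathbb{R}^n\to\mathbb{C}$ be twice differentiable with $\int_{\mathbb{R}^n}\psi(x)\,dx=0$, and let $A$ be a constant such that $$|\psi(x)|,\ \|D\psi(x)\|,\ \|D^2\psi(x)\|\ \le\ A\,(1+|x|)^{-n-2}\qquad\text{for all }x\in\mathbb{R}^n .$$ Let $\tau\in C^2(\mathbb{R}^n;\mathbb{R}^n)$ and put $$\|D\tau\|_\infty=\max_{i,j}\|\partial_j\tau_i\|_{L^\infty},\qquad \|D^2\tau\|_\infty=\max_{i,j,k}\|\partial_k\partial_j\tau_i\|_{L^\infty},\qquad \|\Delta\tau\|_\infty=\sup_{x,y\in\mathbb{R}^n}|\tau(x)-\tau(y)| ,$$ all with values in $[0,\infty]$. Suppose that $\|D\tau\|_\infty\le \frac{1}{2n}$. Let $L_\tau f(x)=f(x-\tau(x))$, let $\mathcal{W}f(x,\lambda)=(f*\psi_\lambda)(x)$ for $x\in\mathbb{R}^n$ and $\lambda>0$, and let $$[\mathcal{W},L_\tau]f(x,\lambda)=\big((L_\tau f)*\psi_\lambda\big)(x)-(f*\psi_\lambda)(x-\tau(x)).$$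 Then $$\big\|[\mathcal{W},L_\tau]\big\|\ \le\ \tilde C_n\,A\left(\|D\tau\|_\infty\Big(\log\frac{\|\Delta\tau\|_\infty}{\|D\tau\|_\infty}\vee 1\Big)+\|D^2\tau\|_\infty\right)$$ in both of the following normalizations: (i) $\psi_\lambda(x)=\lambda^{n/2}\psi(\lambda x)$, with the operator norm from $L^2(\mathbb{R}^n)$ to $L^2\big(\mathbb{R}^n\times(0,\infty),\,dx\,\lambda^{n-1}d\lambda\big)$; (ii) $\psi_\lambda(x)=\lambda^{-n/2}\psi(x/\lambda)$, with the operator norm from $L^2(\mathbb{R}^n)$ to $L^2\big(\mathbb{R}^n\times(0,\infty),\,dx\,\lambda^{-n-1}d\lambda\big)$. Here $a\vee b=\max(a,b)$, and the first term on the right is read as $0$ if $\|D\tau\|_\infty=0$ (that is, if $\tau$ is constant). -/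

import Mathlib

open MeasureTheory
open scoped ENNReal

noncomputable section

namespace WaveletCommutator

/-- Euclidean space `ℝⁿ`. -/
abbrev E (n : ℕ) : Type := EuclideanSpace ℝ (Fin n)

variable {n : ℕ}

/-! ### Dilations and the continuous wavelet transform -/

/-- Dilation by the scale `l > 0`: `x ↦ l ^ (-n/2) ψ(x / l)`. -/
def scaleDilation (ψ : E n → ℂ) (l : ℝ) (x : E n) : ℂ :=
  (l ^ (-((n : ℝ) / 2)) : ℝ) • ψ (l⁻¹ • x)

/-- Dilation by the frequency `l > 0`: `x ↦ l ^ (n/2) ψ(l x)`. -/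
def freqDilation (ψ : E n → ℂ) (l : ℝ) (x : E n) : ℂ :=
  (l ^ ((n : ℝ) / 2) : ℝ) • ψ (l • x)

/-- The measure `dl / l ^ (n+1)` on `(0, ∞)`. -/
def scaleMeasure (n : ℕ) : Measure ℝ :=
  (volume.restrict (Set.Ioi (0 : ℝ))).withDensity fun l => ENNReal.ofReal (l ^ (-((n : ℝ) + 1)))

/-- The measure `l ^ (n-1) dl` on `(0, ∞)`. -/
def freqMeasure (n : ℕ) : Measure ℝ :=
  (volume.restrict (Set.Ioi (0 : ℝ))).withDensity fun l => ENNReal.ofReal (l ^ ((n : ℝ) - 1))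

/-- The wavelet transform `W f (x, l) = (f ⋆ Ψ_l)(x)` of a family `Ψ` of dilated wavelets. -/
def waveletTransform (Ψ : ℝ → E n → ℂ) (f : E n → ℂ) (p : E n × ℝ) : ℂ :=
  convolution f (Ψ p.2) (ContinuousLinearMap.mul ℝ ℂ) volume p.1

/-! ### Deformations and the commutator -/

/-- The deformation operator `L_τ f (x) = f (x - τ x)`. -/
def deform (τ : E n → E n) (f : E n → ℂ) (x : E n) : ℂ :=
  f (x - τ x)

/-- The commutator `[W, L_τ] f = W (L_τ f) - L_τ (W f)`, with `L_τ` acting on the space variable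
of `W f`. -/
def commutator (Ψ : ℝ → E n → ℂ) (τ : E n → E n) (f : E n → ℂ) (p : E n × ℝ) : ℂ :=
  waveletTransform Ψ (deform τ f) p - deform τ (fun x => waveletTransform Ψ f (x, p.2)) p.1

/-- The norm of `T` as an operator from `L²(μ)` to `L²(ν)`: the least `K` such that `T f` is
measurable and `‖T f‖₂ ≤ K ‖f‖₂` for all `f ∈ L²(μ)`; it is `∞` if there is no such `K`. -/
def opNorm₂ {X Y : Type*} [MeasurableSpace X] [MeasurableSpace Y] (μ : Measure X) (ν : Measure Y)
    (T : (X → ℂ) → (Y → ℂ)) : ℝ≥0∞ :=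
  sInf {K : ℝ≥0∞ | ∀ f : X → ℂ, MemLp f 2 μ →
    AEStronglyMeasurable (T f) ν ∧ eLpNorm (T f) 2 ν ≤ K * eLpNorm f 2 μ}

/-- The norm of `[W, L_τ]` from `L²(ℝⁿ)` to `L²(ℝⁿ × (0, ∞), dx dl / l ^ (n+1))`, for the
dilations by scales. -/
def scaleCommutatorNorm (ψ : E n → ℂ) (τ : E n → E n) : ℝ≥0∞ :=
  opNorm₂ volume ((volume : Measure (E n)).prod (scaleMeasure n)) (commutator (scaleDilation ψ) τ)

/-- The norm of `[W, L_τ]` from `L²(ℝⁿ)` to `L²(ℝⁿ × (0, ∞), dx l ^ (n-1) dl)`, for the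
dilations by frequencies. -/
def freqCommutatorNorm (ψ : E n → ℂ) (τ : E n → E n) : ℝ≥0∞ :=
  opNorm₂ volume ((volume : Measure (E n)).prod (freqMeasure n)) (commutator (freqDilation ψ) τ)

/-! ### The size of a deformation -/

/-- `‖Dτ‖_∞`, the largest `L^∞` norm of an entry `∂_j τ_i` of the Jacobian matrix. The largest
entry is at most every usual matrix norm. -/
def normD (τ : E n → E n) : ℝ≥0∞ :=
  ⨆ (i : Fin n) (j : Fin n),
    eLpNorm (fun x => fderiv ℝ τ x (EuclideanSpace.single j 1) i) ∞ volume

/-- `‖D²τ‖_∞`, the largest `L^∞` norm of a second partial derivative `∂_k ∂_j τ_i`. -/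
def normD2 (τ : E n → E n) : ℝ≥0∞ :=
  ⨆ (i : Fin n) (j : Fin n) (k : Fin n),
    eLpNorm (fun x => fderiv ℝ (fderiv ℝ τ) x (EuclideanSpace.single k 1)
      (EuclideanSpace.single j 1) i) ∞ volume

/-- `‖Δτ‖_∞`, the supremum of `|τ x - τ y|` over all `x` and `y`. -/
def normDelta (τ : E n → E n) : ℝ≥0∞ :=
  ⨆ (x : E n) (y : E n), ‖τ x - τ y‖ₑ

/-- `‖Dτ‖_∞ (log (‖Δτ‖_∞ / ‖Dτ‖_∞) ∨ 1) + ‖D²τ‖_∞`, with values in `[0, ∞]`. Passing from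
`[-∞, ∞]` to `[0, ∞]` replaces a negative logarithm by `0`, which the maximum with `1` hides.
The first term is `0` if `‖Dτ‖_∞ = 0`. -/
def deformationSize (τ : E n → E n) : ℝ≥0∞ :=
  normD τ * max (ENNReal.log (normDelta τ / normD τ)).toENNReal 1 + normD2 τ

/-! ### The wavelets -/

/-- `ψ` is twice differentiable, has integral zero, and `ψ` and its first and second derivatives
are bounded by `A (1 + |x|) ^ (-n-2)`. -/
structure IsDecayingWavelet (ψ : E n → ℂ) (A : ℝ) : Prop where
  differentiable : Differentiable ℝ ψ
  differentiable_fderiv : Differentiable ℝ (fderiv ℝ ψ)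
  norm_le : ∀ x, ‖ψ x‖ ≤ A * (1 + ‖x‖) ^ (-((n : ℝ) + 2))
  norm_fderiv_le : ∀ x, ‖fderiv ℝ ψ x‖ ≤ A * (1 + ‖x‖) ^ (-((n : ℝ) + 2))
  norm_fderiv_fderiv_le :
    ∀ x, ‖fderiv ℝ (fderiv ℝ ψ) x‖ ≤ A * (1 + ‖x‖) ^ (-((n : ℝ) + 2))
  integral_eq_zero : ∫ x, ψ x = 0

end WaveletCommutator

end

/-! ### Schur's test and the `T T*` method -/

namespace WaveletCommutator
section
variable {X Y : Type*} [MeasurableSpace X] [MeasurableSpace Y]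

/-! Work with scales `t`. Substituting `z = y - τ y` in `(f * ψ_t)(x - τ x)` writes both halves of
the commutator as integrals against the same function `g = L_τ f`. Up to the factor `t^(n/2)`, the
commutator is `∫ k_t(x, y) g(y) dy`, where `k_t(x, y) = ψ_t(x - y) - j(y) ψ_t((x - τ x) - (y - τ
y))`, the dilations `ψ_t` are `L¹`-normalized and `j = |det(I - Dτ)|` (`commutator_eq`). The factor
`t^(n/2)` turns `dt / t^(n+1)` into `dt / t`. Since `y ↦ y - τ y` has a 2-Lipschitz inverse, `‖g‖² ≤
2^n ‖f‖²`. What remains is a square function estimate for `k_t`.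

Small scales `t ≤ 1`: the Jacobian makes `∫ k_t(x, y) dy = 0`. The kernel is of size `A ‖Dτ‖` and is
Lipschitz in `y` at scale `t` with constant of order `A (‖Dτ‖ + ‖D²τ‖)`; the second derivative
enters only through the variation of `j`. Cancellation against regularity gives the kernel of `T_t
T_s*` a factor `min(√(t/s), √(s/t))`, which is integrable for `ds / s`, so Schur's test for `T T*`
bounds the whole square function without a logarithm (`IsSquareKernel.lintegral_le`).

Large scales `t > 1`: the variation of `j` is no longer controlled at scale `t`, so `k_t g` is split
into `(ψ_t(x - y) - ψ_t((x - τ x) - (y - τ y))) (j g)` and `ψ_t(x - y) ((1 - j) g)`. The second part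
is the ordinary wavelet transform of a function of norm `O(‖Dτ‖) ‖g‖`. The first has operator norm
of order `A min(‖Dτ‖, ‖Δτ‖/t)` at scale `t`, and the integral of the square of this minimum for `dt
/ t` produces the logarithm (`lintegral_lintegral_commKernel_le`). This yields only the square root
of the logarithm, which is more than is needed.

The frequency normalization follows from the substitution `λ = 1/t` (`freq_of_scale`). -/

theorem sq_lintegral_mul_le (ν : Measure Y) {κ h : Y → ℝ≥0∞} (hκ : Measurable κ)
    (hh : Measurable h) :
    (∫⁻ y, κ y * h y ∂ν) ^ 2 ≤ (∫⁻ y, κ y ∂ν) * ∫⁻ y, κ y * h y ^ 2 ∂ν := by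
  have hpq : (2 : ℝ).HolderConjugate 2 := Real.HolderConjugate.two_two
  have h1 := ENNReal.lintegral_mul_le_Lp_mul_Lq ν hpq
    (f := fun y => κ y ^ (1 / 2 : ℝ)) (g := fun y => κ y ^ (1 / 2 : ℝ) * h y)
    (by fun_prop) (by fun_prop)
  have e0 : ∀ a : ℝ≥0∞, a ^ (1 / 2 : ℝ) * a ^ (1 / 2 : ℝ) = a := fun a => by
    rw [← ENNReal.rpow_add_of_nonneg _ _ (by norm_num) (by norm_num)]; norm_num
  have e1 : ∀ a : ℝ≥0∞, (a ^ (1 / 2 : ℝ)) ^ (2 : ℝ) = a := fun a => by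
    rw [← ENNReal.rpow_mul]; norm_num
  have e2 : ∀ a : ℝ≥0∞, (a ^ (1 / 2 : ℝ)) ^ 2 = a := fun a => by
    rw [sq, e0]
  simp only [Pi.mul_apply, ← mul_assoc, e0, e1, ENNReal.mul_rpow_of_nonneg _ _ zero_le_two] at h1
  calc (∫⁻ y, κ y * h y ∂ν) ^ 2 ≤ _ := pow_le_pow_left' h1 2
    _ = _ := by
      rw [mul_pow, e2, e2]
      simp only [ENNReal.rpow_two]

theorem sq_lintegral_mul_le_mul_lintegral_sq (ν : Measure Y) {f g : Y → ℝ≥0∞} (hf : Measurable f)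
    (hg : Measurable g) :
    (∫⁻ y, f y * g y ∂ν) ^ 2 ≤ (∫⁻ y, f y ^ 2 ∂ν) * ∫⁻ y, g y ^ 2 ∂ν := by
  have h1 := ENNReal.lintegral_mul_le_Lp_mul_Lq ν Real.HolderConjugate.two_two
    hf.aemeasurable hg.aemeasurable
  have e2 : ∀ a : ℝ≥0∞, (a ^ (1 / 2 : ℝ)) ^ 2 = a := fun a => by
    rw [sq, ← ENNReal.rpow_add_of_nonneg _ _ (by norm_num) (by norm_num)]; norm_num
  calc (∫⁻ y, f y * g y ∂ν) ^ 2 ≤ _ := pow_le_pow_left' h1 2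
    _ = _ := by
      rw [mul_pow, e2, e2]
      simp only [ENNReal.rpow_two]

/-- Schur's test. -/
theorem schur_test {μ : Measure X} {ν : Measure Y} [SFinite μ] [SFinite ν]
    {κ : X → Y → ℝ≥0∞} (hκ : Measurable (Function.uncurry κ)) {M₁ M₂ : ℝ≥0∞}
    (h₁ : ∀ p, ∫⁻ y, κ p y ∂ν ≤ M₁) (h₂ : ∀ y, ∫⁻ p, κ p y ∂μ ≤ M₂)
    {h : Y → ℝ≥0∞} (hh : Measurable h) :
    ∫⁻ p, (∫⁻ y, κ p y * h y ∂ν) ^ 2 ∂μ ≤ M₁ * M₂ * ∫⁻ y, h y ^ 2 ∂ν := by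
  have hm : Measurable fun z : X × Y => κ z.1 z.2 * h z.2 ^ 2 :=
    Measurable.mul hκ (by fun_prop)
  calc ∫⁻ p, (∫⁻ y, κ p y * h y ∂ν) ^ 2 ∂μ
      ≤ ∫⁻ p, M₁ * ∫⁻ y, κ p y * h y ^ 2 ∂ν ∂μ := by
        refine lintegral_mono fun p => ?_
        have hκp : Measurable fun y => κ p y := hκ.comp measurable_prodMk_left
        refine (sq_lintegral_mul_le ν hκp hh).trans ?_
        gcongr
        exact h₁ p
    _ = M₁ * ∫⁻ y, ∫⁻ p, κ p y * h y ^ 2 ∂μ ∂ν := by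
        rw [lintegral_const_mul _ hm.lintegral_prod_right', lintegral_lintegral_swap hm.aemeasurable]
    _ ≤ M₁ * ∫⁻ y, M₂ * h y ^ 2 ∂ν := by
        gcongr with y
        have hκy : Measurable fun p => κ p y := hκ.comp measurable_prodMk_right
        rw [lintegral_mul_const _ hκy]
        gcongr
        exact h₂ y
    _ = _ := by rw [lintegral_const_mul _ (by fun_prop), mul_assoc]

theorem schur_test_swap {μ : Measure X} {ν : Measure Y} [SFinite μ] [SFinite ν]
    {κ : X → Y → ℝ≥0∞} (hκ : Measurable (Function.uncurry κ)) {M₁ M₂ : ℝ≥0∞}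
    (h₁ : ∀ p, ∫⁻ y, κ p y ∂ν ≤ M₁) (h₂ : ∀ y, ∫⁻ p, κ p y ∂μ ≤ M₂)
    {h : X → ℝ≥0∞} (hh : Measurable h) :
    ∫⁻ y, (∫⁻ p, κ p y * h p ∂μ) ^ 2 ∂ν ≤ M₁ * M₂ * ∫⁻ p, h p ^ 2 ∂μ := by
  rw [mul_comm M₁]
  exact schur_test (κ := fun y p => κ p y) (hκ.comp measurable_swap) h₂ h₁ hh

/-- Schur's test for an integral operator with a complex kernel. -/
theorem lintegral_enorm_integral_sq_le {μ : Measure X} {ν : Measure Y} [SFinite μ] [SFinite ν]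
    {k : X → Y → ℂ} (hk : Measurable (Function.uncurry k)) {M₁ M₂ : ℝ≥0∞}
    (h₁ : ∀ p, ∫⁻ y, ‖k p y‖ₑ ∂ν ≤ M₁) (h₂ : ∀ y, ∫⁻ p, ‖k p y‖ₑ ∂μ ≤ M₂)
    {f : Y → ℂ} (hf : Measurable f) :
    ∫⁻ p, ‖∫ y, k p y * f y ∂ν‖ₑ ^ 2 ∂μ ≤ M₁ * M₂ * ∫⁻ y, ‖f y‖ₑ ^ 2 ∂ν := by
  refine le_trans (lintegral_mono fun p => ?_) (schur_test (κ := fun p y => ‖k p y‖ₑ)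
    hk.enorm h₁ h₂ hf.enorm)
  gcongr
  refine (enorm_integral_le_lintegral_enorm _).trans_eq ?_
  simp only [enorm_mul]

/-- The adjoint estimate: if the kernel of `T T*` satisfies Schur's test with constant `B`, then
`‖T* g‖² ≤ B ‖g‖²`. -/
theorem lintegral_enorm_adjoint_sq_le {μ : Measure X} {ν : Measure Y} [SFinite μ] [SFinite ν]
    {k : X → Y → ℂ} (hk : Measurable (Function.uncurry k)) {M B : ℝ≥0∞} (hM : M ≠ ∞)
    (h₁ : ∀ p, ∫⁻ y, ‖k p y‖ₑ ∂ν ≤ M) (h₂ : ∀ y, ∫⁻ p, ‖k p y‖ₑ ∂μ ≤ M)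
    (hB : ∀ p, ∫⁻ q, ‖∫ y, k p y * starRingEnd ℂ (k q y) ∂ν‖ₑ ∂μ ≤ B)
    {g : X → ℂ} (hg : Measurable g) (hg2 : ∫⁻ p, ‖g p‖ₑ ^ 2 ∂μ ≠ ∞) :
    ∫⁻ y, ‖∫ p, k p y * g p ∂μ‖ₑ ^ 2 ∂ν ≤ B * ∫⁻ p, ‖g p‖ₑ ^ 2 ∂μ := by
  set Q : X → X → ℂ := fun p q => ∫ y, k p y * starRingEnd ℂ (k q y) ∂ν with hQ
  have hconj : Measurable (starRingEnd ℂ) := Complex.continuous_conj.measurable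
  have hQm : Measurable (Function.uncurry Q) := by
    have : Measurable fun z : (X × X) × Y => k z.1.1 z.2 * starRingEnd ℂ (k z.1.2 z.2) := by
      refine Measurable.mul ?_ (hconj.comp ?_)
      · exact hk.comp (by fun_prop : Measurable fun z : (X × X) × Y => (z.1.1, z.2))
      · exact hk.comp (by fun_prop : Measurable fun z : (X × X) × Y => (z.1.2, z.2))
    exact this.stronglyMeasurable.integral_prod_right'.measurable
  set a : X → Y → ℂ := fun p y => k p y * g p with ha
  have ham : Measurable (Function.uncurry a) := hk.mul (hg.comp measurable_fst)
  -- The crude Schur bound with `M` serves only to make the integrals below absolutely convergent;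
  -- `M` does not enter the conclusion.
  have hS : ∫⁻ y, (∫⁻ p, ‖a p y‖ₑ ∂μ) ^ 2 ∂ν < ∞ := by
    simp only [ha, enorm_mul]
    refine lt_of_le_of_lt (schur_test_swap (κ := fun p y => ‖k p y‖ₑ) hk.enorm h₁ h₂ hg.enorm) ?_
    exact ENNReal.mul_lt_top (ENNReal.mul_lt_top hM.lt_top hM.lt_top) hg2.lt_top
  have hbm : Measurable fun z : Y × (X × X) => a z.2.1 z.1 * starRingEnd ℂ (a z.2.2 z.1) := by
    refine Measurable.mul ?_ (hconj.comp ?_)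
    · exact ham.comp (by fun_prop : Measurable fun z : Y × (X × X) => (z.2.1, z.1))
    · exact ham.comp (by fun_prop : Measurable fun z : Y × (X × X) => (z.2.2, z.1))
  have hsq : ∀ y, ∫⁻ z : X × X, ‖a z.1 y * starRingEnd ℂ (a z.2 y)‖ₑ ∂(μ.prod μ)
      = (∫⁻ p, ‖a p y‖ₑ ∂μ) ^ 2 := by
    intro y
    have hay : Measurable fun p => a p y := ham.comp measurable_prodMk_right
    simp only [enorm_mul, RCLike.enorm_conj]
    rw [lintegral_prod_mul hay.enorm.aemeasurable hay.enorm.aemeasurable, sq]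
  have hint : Integrable (Function.uncurry fun (y : Y) (z : X × X) =>
      a z.1 y * starRingEnd ℂ (a z.2 y)) (ν.prod (μ.prod μ)) := by
    refine ⟨hbm.aestronglyMeasurable, ?_⟩
    have e := lintegral_prod (μ := ν) (ν := μ.prod μ) _ hbm.enorm.aemeasurable
    simp only [hsq] at e
    exact e.trans_lt hS
  -- Expanding the square and exchanging the integrals turns `‖T* g‖²` into the quadratic form of
  -- the kernel `Q` of `T T*`.
  have key : ∫ y, (∫ p, a p y ∂μ) * starRingEnd ℂ (∫ p, a p y ∂μ) ∂ν
      = ∫ z : X × X, Q z.1 z.2 * (g z.1 * starRingEnd ℂ (g z.2)) ∂(μ.prod μ) := by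
    have e1 : ∀ y, (∫ p, a p y ∂μ) * starRingEnd ℂ (∫ p, a p y ∂μ)
        = ∫ z : X × X, a z.1 y * starRingEnd ℂ (a z.2 y) ∂(μ.prod μ) := by
      intro y
      rw [← integral_conj, integral_prod_mul (fun p => a p y) (fun p => starRingEnd ℂ (a p y))]
    simp only [e1]
    rw [integral_integral_swap hint]
    refine integral_congr_ae (Filter.Eventually.of_forall fun z => ?_)
    simp only [hQ, ha, map_mul]
    rw [← integral_mul_const]
    congr 1
    ext y
    ring
  have e3 : ∫⁻ y, ‖∫ p, a p y ∂μ‖ₑ ^ 2 ∂ν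
      ≤ ∫⁻ z : X × X, ‖Q z.1 z.2 * (g z.1 * starRingEnd ℂ (g z.2))‖ₑ ∂(μ.prod μ) := by
    have hTm : Measurable fun y => ∫ p, a p y ∂μ :=
      (ham.comp measurable_swap).stronglyMeasurable.integral_prod_right'.measurable
    have hfin : ∫⁻ y, ‖∫ p, a p y ∂μ‖ₑ ^ 2 ∂ν < ∞ := by
      refine lt_of_le_of_lt (lintegral_mono fun y => ?_) hS
      gcongr
      exact enorm_integral_le_lintegral_enorm _
    have e4 : ∀ y, (∫ p, a p y ∂μ) * starRingEnd ℂ (∫ p, a p y ∂μ)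
        = ((‖∫ p, a p y ∂μ‖ ^ 2 : ℝ) : ℂ) := fun y => by
      rw [Complex.mul_conj, Complex.normSq_eq_norm_sq]
    refine le_trans ?_ (enorm_integral_le_lintegral_enorm _)
    rw [← key]
    simp only [e4]
    rw [integral_complex_ofReal]
    have e5 : ∀ y, ‖∫ p, a p y ∂μ‖ₑ ^ 2 = ENNReal.ofReal (‖∫ p, a p y ∂μ‖ ^ 2) := fun y => by
      rw [ENNReal.ofReal_pow (norm_nonneg _), ofReal_norm]
    simp only [e5] at hfin ⊢
    rw [← ofReal_integral_eq_lintegral_ofReal ?_ (Filter.Eventually.of_forall fun y => by positivity)]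
    · rw [← ofReal_norm]
      refine ENNReal.ofReal_le_ofReal ?_
      rw [Complex.norm_real]
      exact le_abs_self _
    · refine ⟨(hTm.norm.pow_const 2).aestronglyMeasurable, ?_⟩
      rw [HasFiniteIntegral]
      refine lt_of_le_of_lt (lintegral_mono fun y => ?_) hfin
      rw [Real.enorm_eq_ofReal (by positivity)]
  refine e3.trans ?_
  -- `Q` is Hermitian, so the single Schur bound `hB` controls both halves of the AM-GM splitting
  -- below.
  have hQs : ∀ p q, ‖Q p q‖ₑ = ‖Q q p‖ₑ := by
    intro p q
    rw [← RCLike.enorm_conj (Q q p)]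
    congr 1
    simp only [hQ]
    rw [← integral_conj]
    congr 1
    ext y
    simp [mul_comm]
  have hm1 : Measurable fun z : X × X => ‖Q z.1 z.2‖ₑ * ‖g z.1‖ₑ ^ 2 :=
    hQm.enorm.mul (by fun_prop)
  have hm2 : Measurable fun z : X × X => ‖Q z.1 z.2‖ₑ * ‖g z.2‖ₑ ^ 2 :=
    hQm.enorm.mul (by fun_prop)
  have b1 : ∫⁻ z : X × X, ‖Q z.1 z.2‖ₑ * ‖g z.1‖ₑ ^ 2 ∂(μ.prod μ)
      ≤ B * ∫⁻ p, ‖g p‖ₑ ^ 2 ∂μ := by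
    rw [lintegral_prod _ hm1.aemeasurable, ← lintegral_const_mul _ (by fun_prop)]
    refine lintegral_mono fun p => ?_
    have hQp : Measurable fun q => ‖Q p q‖ₑ := hQm.enorm.comp measurable_prodMk_left
    dsimp only
    rw [lintegral_mul_const _ hQp]
    gcongr
    exact hB p
  have b2 : ∫⁻ z : X × X, ‖Q z.1 z.2‖ₑ * ‖g z.2‖ₑ ^ 2 ∂(μ.prod μ)
      ≤ B * ∫⁻ p, ‖g p‖ₑ ^ 2 ∂μ := by
    rw [← lintegral_prod_swap]
    simp only [Prod.fst_swap, Prod.snd_swap]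
    refine le_trans (lintegral_mono fun z => ?_) b1
    rw [hQs]
  have amgm : ∀ c d : ℝ≥0∞, c * d ≤ 2⁻¹ * (c ^ 2 + d ^ 2) := by
    intro c d
    rw [← ENNReal.mul_le_iff_le_inv (by norm_num) (by norm_num)]
    rcases eq_or_ne c ∞ with rfl | hc
    · simp
    rcases eq_or_ne d ∞ with rfl | hd
    · simp
    lift c to NNReal using hc
    lift d to NNReal using hd
    norm_cast
    rw [← mul_assoc]
    exact two_mul_le_add_sq c d
  calc ∫⁻ z : X × X, ‖Q z.1 z.2 * (g z.1 * starRingEnd ℂ (g z.2))‖ₑ ∂(μ.prod μ)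
      ≤ ∫⁻ z : X × X, 2⁻¹ * (‖Q z.1 z.2‖ₑ * ‖g z.1‖ₑ ^ 2 + ‖Q z.1 z.2‖ₑ * ‖g z.2‖ₑ ^ 2)
          ∂(μ.prod μ) := by
        refine lintegral_mono fun z => ?_
        simp only [enorm_mul, RCLike.enorm_conj]
        rw [← mul_add, mul_left_comm (2⁻¹)]
        exact mul_le_mul_right (amgm _ _) _
    _ ≤ 2⁻¹ * (B * ∫⁻ p, ‖g p‖ₑ ^ 2 ∂μ + B * ∫⁻ p, ‖g p‖ₑ ^ 2 ∂μ) := by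
        rw [lintegral_const_mul _ (by exact hm1.add hm2), lintegral_add_left hm1]
        gcongr
    _ = _ := by
        rw [← two_mul, ← mul_assoc, ENNReal.inv_mul_cancel (by norm_num) (by norm_num), one_mul]

/-- The `T T*` method: if the kernel of `T T*` satisfies Schur's test with constant `B`, then
`‖T f‖² ≤ B ‖f‖²`. -/
theorem lintegral_enorm_sq_le_of_kernel_mul_adjoint {μ : Measure X} {ν : Measure Y} [SFinite μ]
    [SFinite ν] {k : X → Y → ℂ} (hk : Measurable (Function.uncurry k)) {M B : ℝ≥0∞} (hM : M ≠ ∞)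
    (h₁ : ∀ p, ∫⁻ y, ‖k p y‖ₑ ∂ν ≤ M) (h₂ : ∀ y, ∫⁻ p, ‖k p y‖ₑ ∂μ ≤ M)
    (hB : ∀ p, ∫⁻ q, ‖∫ y, k p y * starRingEnd ℂ (k q y) ∂ν‖ₑ ∂μ ≤ B)
    {f : Y → ℂ} (hf : Measurable f) (hf2 : ∫⁻ y, ‖f y‖ₑ ^ 2 ∂ν ≠ ∞) :
    ∫⁻ p, ‖∫ y, k p y * f y ∂ν‖ₑ ^ 2 ∂μ ≤ B * ∫⁻ y, ‖f y‖ₑ ^ 2 ∂ν := by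
  have hconj : Measurable (starRingEnd ℂ) := Complex.continuous_conj.measurable
  set G : X → ℂ := fun p => ∫ y, k p y * f y ∂ν with hG
  have hkf : Measurable fun z : X × Y => k z.1 z.2 * f z.2 := Measurable.mul hk (by fun_prop)
  have hGm : Measurable G := hkf.stronglyMeasurable.integral_prod_right'.measurable
  set N := ∫⁻ p, ‖G p‖ₑ ^ 2 ∂μ with hN
  -- Finiteness is needed to cancel `N` at the end; the crude Schur bound suffices for it.
  have hNfin : N ≠ ∞ := by
    refine ((lintegral_enorm_integral_sq_le hk h₁ h₂ hf).trans_lt ?_).ne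
    exact ENNReal.mul_lt_top (ENNReal.mul_lt_top hM.lt_top hM.lt_top) hf2.lt_top
  -- The adjoint estimate is stated with `k` rather than its conjugate, hence the conjugate of `G`.
  set G' : X → ℂ := fun p => starRingEnd ℂ (G p) with hG'
  have hG'm : Measurable G' := hconj.comp hGm
  have hN' : ∫⁻ p, ‖G' p‖ₑ ^ 2 ∂μ = N := by simp only [hG', RCLike.enorm_conj, hN]
  have hadj := lintegral_enorm_adjoint_sq_le hk hM h₁ h₂ hB hG'm (by rwa [hN'])
  rw [hN'] at hadj
  have hkG : Measurable fun z : X × Y => k z.1 z.2 * G' z.1 := Measurable.mul hk (by fun_prop)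
  have hHm : Measurable fun y => ∫ p, k p y * G' p ∂μ :=
    (hkG.comp measurable_swap).stronglyMeasurable.integral_prod_right'.measurable
  have hint : Integrable (Function.uncurry fun p y => k p y * f y * G' p) (μ.prod ν) := by
    have hm : Measurable (Function.uncurry fun p y => k p y * f y * G' p) :=
      Measurable.mul hkf (by fun_prop)
    refine ⟨hm.aestronglyMeasurable, ?_⟩
    rw [HasFiniteIntegral, lintegral_prod_symm _ hm.enorm.aemeasurable]
    have hle : (∫⁻ y, ∫⁻ p, ‖k p y * f y * G' p‖ₑ ∂μ ∂ν) ^ 2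
        ≤ (∫⁻ y, ‖f y‖ₑ ^ 2 ∂ν) * ∫⁻ y, (∫⁻ p, ‖k p y‖ₑ * ‖G' p‖ₑ ∂μ) ^ 2 ∂ν := by
      have hmm : Measurable fun z : X × Y => ‖k z.1 z.2‖ₑ * ‖G' z.1‖ₑ :=
        hk.enorm.mul (by fun_prop)
      have hmy : Measurable fun y => ∫⁻ p, ‖k p y‖ₑ * ‖G' p‖ₑ ∂μ :=
        (hmm.comp measurable_swap).lintegral_prod_right'
      have := sq_lintegral_mul_le_mul_lintegral_sq ν hf.enorm hmy
      refine le_trans (le_of_eq ?_) this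
      congr 2
      ext y
      have hmp : Measurable fun p => ‖k p y‖ₑ * ‖G' p‖ₑ := hmm.comp measurable_prodMk_right
      rw [← lintegral_const_mul _ hmp]
      congr 1
      ext p
      simp only [enorm_mul]
      ring
    have hlt : (∫⁻ y, ∫⁻ p, ‖k p y * f y * G' p‖ₑ ∂μ ∂ν) ^ 2 < ∞ := by
      refine hle.trans_lt (ENNReal.mul_lt_top hf2.lt_top ?_)
      refine (schur_test_swap (κ := fun p y => ‖k p y‖ₑ) hk.enorm h₁ h₂ hG'm.enorm).trans_lt ?_
      rw [hN']
      exact ENNReal.mul_lt_top (ENNReal.mul_lt_top hM.lt_top hM.lt_top) hNfin.lt_top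
    exact (ENNReal.pow_lt_top_iff).1 hlt |>.resolve_right (by norm_num)
  have e5 : ∀ p, ‖G p‖ₑ ^ 2 = ENNReal.ofReal (‖G p‖ ^ 2) := fun p => by
    rw [ENNReal.ofReal_pow (norm_nonneg _), ofReal_norm]
  have hGint : Integrable (fun p => ‖G p‖ ^ 2) μ := by
    refine ⟨(hGm.norm.pow_const 2).aestronglyMeasurable, ?_⟩
    rw [HasFiniteIntegral]
    refine lt_of_le_of_lt (lintegral_mono fun p => ?_) hNfin.lt_top
    rw [Real.enorm_eq_ofReal (by positivity), e5]
  -- Duality: `‖T f‖²` is the pairing of `f` with the adjoint applied to `T f`. Cauchy-Schwarz then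
  -- gives `N² ≤ B ‖f‖² N`.
  have hNle : N ≤ ∫⁻ y, ‖f y‖ₑ * ‖∫ p, k p y * G' p ∂μ‖ₑ ∂ν := by
    have e6 : ((∫ p, ‖G p‖ ^ 2 ∂μ : ℝ) : ℂ) = ∫ y, f y * ∫ p, k p y * G' p ∂μ ∂ν := by
      rw [← integral_complex_ofReal]
      calc ∫ p, ((‖G p‖ ^ 2 : ℝ) : ℂ) ∂μ = ∫ p, ∫ y, k p y * f y * G' p ∂ν ∂μ := by
            congr 1
            ext p
            rw [integral_mul_const]
            change _ = G p * starRingEnd ℂ (G p)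
            rw [Complex.mul_conj, Complex.normSq_eq_norm_sq]
        _ = ∫ y, ∫ p, k p y * f y * G' p ∂μ ∂ν := integral_integral_swap hint
        _ = _ := by
            congr 1
            ext y
            rw [← integral_const_mul]
            congr 1
            ext p
            ring
    have e7 : N = ‖∫ y, f y * ∫ p, k p y * G' p ∂μ ∂ν‖ₑ := by
      rw [← e6, ← ofReal_norm, Complex.norm_real, Real.norm_of_nonneg
        (integral_nonneg fun p => by positivity), ofReal_integral_eq_lintegral_ofReal hGint
        (Filter.Eventually.of_forall fun y => by positivity), hN]
      simp only [e5]
    rw [e7]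
    refine (enorm_integral_le_lintegral_enorm _).trans_eq ?_
    simp only [enorm_mul]
  have hsq : N ^ 2 ≤ (B * ∫⁻ y, ‖f y‖ₑ ^ 2 ∂ν) * N := by
    calc N ^ 2 ≤ _ := pow_le_pow_left' hNle 2
      _ ≤ _ := sq_lintegral_mul_le_mul_lintegral_sq ν hf.enorm hHm.enorm
      _ ≤ (∫⁻ y, ‖f y‖ₑ ^ 2 ∂ν) * (B * N) := by gcongr
      _ = _ := by ring
  rcases eq_or_ne N 0 with h0 | h0
  · rw [h0]; exact zero_le
  · rw [sq] at hsq
    exact (ENNReal.mul_le_mul_iff_left h0 hNfin).1 hsq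

end
end WaveletCommutator

/-! ### Square functions by almost orthogonality -/

namespace WaveletCommutator
section
variable {n : ℕ}

/-- The dilated bump `t ^ (-n) (1 + |u| / t) ^ (-r)`. -/
noncomputable def bump (r t : ℝ) (u : E n) : ℝ := (t ^ n)⁻¹ * (1 + ‖t⁻¹ • u‖) ^ (-r)

/-- The mass of the bump with exponent `r`. -/
noncomputable def bumpMass (n : ℕ) (r : ℝ) : ℝ≥0∞ :=
  ∫⁻ u : E n, ENNReal.ofReal ((1 + ‖u‖) ^ (-r))

theorem bumpMass_lt_top {r : ℝ} (hr : (n : ℝ) < r) : bumpMass n r < ∞ := by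
  have h := integrable_one_add_norm (E := E n) (μ := volume) (r := r) (by simpa using hr)
  have h2 := h.2
  rw [HasFiniteIntegral] at h2
  refine lt_of_eq_of_lt (lintegral_congr fun u => ?_) h2
  rw [Real.enorm_eq_ofReal (by positivity)]

theorem bump_nonneg {r t : ℝ} (ht : 0 < t) (u : E n) : 0 ≤ bump r t u := by
  unfold bump; positivity

theorem bump_anti {r s t : ℝ} (ht : 0 < t) (hrs : r ≤ s) (u : E n) : bump s t u ≤ bump r t u := by
  unfold bump
  gcongr
  linarith [norm_nonneg (t⁻¹ • u)]

@[fun_prop]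
theorem measurable_bump {α : Type*} [MeasurableSpace α] {r : ℝ} {t : α → ℝ} {u : α → E n}
    (ht : Measurable t) (hu : Measurable u) : Measurable fun a => bump r (t a) (u a) := by
  unfold bump
  fun_prop

theorem lintegral_comp_inv_smul {t : ℝ} (ht : 0 < t) {g : E n → ℝ≥0∞} (hg : Measurable g) :
    ∫⁻ u, g (t⁻¹ • u) = ENNReal.ofReal (t ^ n) * ∫⁻ u, g u := by
  have h := Measure.map_addHaar_smul (volume : Measure (E n)) (inv_ne_zero ht.ne')
  rw [← lintegral_map hg (measurable_const_smul t⁻¹), h, lintegral_smul_measure]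
  simp [abs_of_pos ht]

theorem lintegral_bump {r t : ℝ} (ht : 0 < t) :
    ∫⁻ u : E n, ENNReal.ofReal (bump r t u) = bumpMass n r := by
  have ht' : 0 < t ^ n := by positivity
  unfold bump bumpMass
  simp_rw [ENNReal.ofReal_mul (inv_nonneg.2 ht'.le)]
  rw [lintegral_const_mul _ (by fun_prop),
    lintegral_comp_inv_smul ht (g := fun u : E n => ENNReal.ofReal ((1 + ‖u‖) ^ (-r)))
      (by fun_prop), ← mul_assoc, ← ENNReal.ofReal_mul (inv_nonneg.2 ht'.le),
    inv_mul_cancel₀ ht'.ne']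
  simp

theorem lintegral_bump_sub_left {r t : ℝ} (ht : 0 < t) (x : E n) :
    ∫⁻ y, ENNReal.ofReal (bump r t (x - y)) = bumpMass n r := by
  rw [lintegral_sub_left_eq_self (fun u => ENNReal.ofReal (bump r t u)), lintegral_bump ht]

theorem lintegral_bump_sub_right {r t : ℝ} (ht : 0 < t) (y : E n) :
    ∫⁻ x, ENNReal.ofReal (bump r t (x - y)) = bumpMass n r := by
  rw [lintegral_sub_right_eq_self (fun u => ENNReal.ofReal (bump r t u)), lintegral_bump ht]

/-- Half a power of decay pays for a Hölder weight of exponent `1/2`. Starting from the exponent `n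
+ 1`, what is left is `n + 1/2`, still above the threshold `n` of integrability. -/
theorem sqrt_mul_bump_le {r t : ℝ} (ht : 0 < t) (u : E n) :
    √(‖u‖ / t) * bump (r + 1 / 2) t u ≤ bump r t u := by
  unfold bump
  have h1 : 0 < 1 + ‖t⁻¹ • u‖ := by positivity
  have h2 : √(‖u‖ / t) ≤ (1 + ‖t⁻¹ • u‖) ^ (1 / 2 : ℝ) := by
    rw [Real.sqrt_eq_rpow]
    gcongr
    rw [norm_smul, Real.norm_of_nonneg (by positivity), div_eq_inv_mul]
    linarith
  calc √(‖u‖ / t) * ((t ^ n)⁻¹ * (1 + ‖t⁻¹ • u‖) ^ (-(r + 1 / 2)))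
      ≤ (1 + ‖t⁻¹ • u‖) ^ (1 / 2 : ℝ) * ((t ^ n)⁻¹ * (1 + ‖t⁻¹ • u‖) ^ (-(r + 1 / 2))) := by
        gcongr
    _ = _ := by
        rw [mul_left_comm, ← Real.rpow_add h1]
        congr 2
        ring

/-- Kernels `k t x y` of size at most `B` adapted to the scale `t > 0`, Lipschitz in `y` at that
scale, with integral zero in `y`. -/
structure IsSquareKernel (k : ℝ → E n → E n → ℂ) (B : ℝ) : Prop where
  measurable : Measurable fun z : ℝ × E n × E n => k z.1 z.2.1 z.2.2
  norm_le : ∀ t, 0 < t → ∀ x y, ‖k t x y‖ ≤ B * bump ((n : ℝ) + 1) t (x - y)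
  norm_sub_le : ∀ t, 0 < t → ∀ x y y', ‖y - y'‖ ≤ t / 2 →
    ‖k t x y - k t x y'‖ ≤ B * (‖y - y'‖ / t) * bump ((n : ℝ) + 1) t (x - y)
  integral_eq_zero : ∀ t, 0 < t → ∀ x, ∫ y, k t x y = 0

namespace IsSquareKernel
variable {k : ℝ → E n → E n → ℂ} {B : ℝ}

theorem nonneg (hk : IsSquareKernel k B) : 0 ≤ B := by
  have h := (norm_nonneg _).trans (hk.norm_le 1 one_pos 0 0)
  have h2 : 0 < bump ((n : ℝ) + 1) 1 ((0 : E n) - 0) := by unfold bump; positivity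
  exact nonneg_of_mul_nonneg_left h h2

theorem norm_le' (hk : IsSquareKernel k B) {t : ℝ} (ht : 0 < t) (x y : E n) :
    ‖k t x y‖ ≤ B * bump ((n : ℝ) + 1 / 2) t (x - y) :=
  (hk.norm_le t ht x y).trans
    (mul_le_mul_of_nonneg_left (bump_anti ht (by linarith) _) hk.nonneg)

/-- Interpolation between regularity and size, valid without restriction on `y` and `y'`. With `e =
‖y - y'‖ / t`, the Lipschitz bound suffices when `e ≤ 1/2`, since then `e ≤ √e`; otherwise `1 ≤ 2√e`
and the two size bounds are added. Exponent `1/2` is used because the decay of the kernel cannot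
absorb the full factor `e` and remain integrable. -/
theorem holder (hk : IsSquareKernel k B) {t : ℝ} (ht : 0 < t) (x y y' : E n) :
    ‖k t x y - k t x y'‖ ≤ 2 * B * √(‖y - y'‖ / t) *
      (bump ((n : ℝ) + 1 / 2) t (x - y) + bump ((n : ℝ) + 1 / 2) t (x - y')) := by
  have hB := hk.nonneg
  have b1 := bump_nonneg (r := (n : ℝ) + 1 / 2) ht (x - y)
  have b2 := bump_nonneg (r := (n : ℝ) + 1 / 2) ht (x - y')
  have b0 := bump_nonneg (r := (n : ℝ) + 1) ht (x - y)
  have b3 : bump ((n : ℝ) + 1) t (x - y) ≤ bump ((n : ℝ) + 1 / 2) t (x - y) :=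
    bump_anti ht (by linarith) _
  have he : 0 ≤ ‖y - y'‖ / t := by positivity
  rcases le_or_gt ‖y - y'‖ (t / 2) with h | h
  · have he2 : ‖y - y'‖ / t ≤ 1 := by
      rw [div_le_one ht]; linarith
    have hs : ‖y - y'‖ / t ≤ √(‖y - y'‖ / t) := Real.le_sqrt_of_sq_le (by nlinarith)
    calc _ ≤ _ := hk.norm_sub_le t ht x y y' h
      _ ≤ B * √(‖y - y'‖ / t) * bump ((n : ℝ) + 1 / 2) t (x - y) := by gcongr
      _ ≤ 2 * B * √(‖y - y'‖ / t) *
          (bump ((n : ℝ) + 1 / 2) t (x - y) + bump ((n : ℝ) + 1 / 2) t (x - y')) := by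
        gcongr <;> linarith
  · have hs : 1 ≤ 2 * √(‖y - y'‖ / t) := by
      have h1 : (1 / 2 : ℝ) ≤ √(‖y - y'‖ / t) := by
        apply Real.le_sqrt_of_sq_le
        rw [le_div_iff₀ ht]
        linarith
      linarith
    calc ‖k t x y - k t x y'‖ ≤ ‖k t x y‖ + ‖k t x y'‖ := _root_.norm_sub_le _ _
      _ ≤ B * bump ((n : ℝ) + 1 / 2) t (x - y) + B * bump ((n : ℝ) + 1 / 2) t (x - y') :=
        add_le_add (hk.norm_le' ht x y) (hk.norm_le' ht x y')
      _ = 1 * (B * (bump ((n : ℝ) + 1 / 2) t (x - y) + bump ((n : ℝ) + 1 / 2) t (x - y'))) := by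
        ring
      _ ≤ 2 * √(‖y - y'‖ / t) *
          (B * (bump ((n : ℝ) + 1 / 2) t (x - y) + bump ((n : ℝ) + 1 / 2) t (x - y'))) := by
        gcongr
      _ = _ := by ring

theorem enorm_le (hk : IsSquareKernel k B) {t : ℝ} (ht : 0 < t) (x y : E n) :
    ‖k t x y‖ₑ ≤ ENNReal.ofReal B * ENNReal.ofReal (bump ((n : ℝ) + 1 / 2) t (x - y)) := by
  rw [← ENNReal.ofReal_mul hk.nonneg, ← ofReal_norm]
  exact ENNReal.ofReal_le_ofReal (hk.norm_le' ht x y)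

theorem measurable_right (hk : IsSquareKernel k B) (t : ℝ) (x : E n) :
    Measurable fun y => k t x y :=
  hk.measurable.comp (by fun_prop : Measurable fun y : E n => (t, x, y))

theorem lintegral_left_le (hk : IsSquareKernel k B) {t : ℝ} (ht : 0 < t) (x : E n) :
    ∫⁻ y, ‖k t x y‖ₑ ≤ ENNReal.ofReal B * bumpMass n ((n : ℝ) + 1 / 2) := by
  rw [← lintegral_bump_sub_left ht x, ← lintegral_const_mul _ (by fun_prop)]
  exact lintegral_mono fun y => hk.enorm_le ht x y

theorem lintegral_right_le (hk : IsSquareKernel k B) {t : ℝ} (ht : 0 < t) (y : E n) :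
    ∫⁻ x, ‖k t x y‖ₑ ≤ ENNReal.ofReal B * bumpMass n ((n : ℝ) + 1 / 2) := by
  rw [← lintegral_bump_sub_right ht y, ← lintegral_const_mul _ (by fun_prop)]
  exact lintegral_mono fun x => hk.enorm_le ht x y

theorem integrable (hk : IsSquareKernel k B) {t : ℝ} (ht : 0 < t) (x : E n) :
    Integrable fun y => k t x y := by
  refine ⟨(hk.measurable_right t x).aestronglyMeasurable, ?_⟩
  exact (hk.lintegral_left_le ht x).trans_lt
    (ENNReal.mul_lt_top ENNReal.ofReal_lt_top (bumpMass_lt_top (by linarith)))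

/-- The kernel of `T_t T_s*` gains a factor `√(t / s)`. -/
theorem enorm_integral_mul_conj_le (hk : IsSquareKernel k B) {t s : ℝ} (ht : 0 < t) (hs : 0 < s)
    (x x' : E n) :
    ‖∫ y, k t x y * starRingEnd ℂ (k s x' y)‖ₑ ≤ ENNReal.ofReal (2 * B ^ 2 * √(t / s)) *
      ∫⁻ y, ENNReal.ofReal (bump ((n : ℝ) + 1 / 2) t (x - y)) *
        (ENNReal.ofReal (bump ((n : ℝ) + 1 / 2) s (x' - y)) +
          ENNReal.ofReal (bump ((n : ℝ) + 1 / 2) s (x' - x))) := by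
  have hB := hk.nonneg
  have hconj : Measurable (starRingEnd ℂ) := Complex.continuous_conj.measurable
  have hint : Integrable fun y => k t x y * starRingEnd ℂ (k s x' y) := by
    refine (hk.integrable ht x).mul_bdd (c := B * (s ^ n)⁻¹)
      (hconj.comp (hk.measurable_right s x')).aestronglyMeasurable
      (Filter.Eventually.of_forall fun y => ?_)
    rw [RCLike.norm_conj]
    refine (hk.norm_le s hs x' y).trans ?_
    unfold bump
    gcongr
    refine mul_le_of_le_one_right (by positivity) ?_
    exact Real.rpow_le_one_of_one_le_of_nonpos (by linarith [norm_nonneg (s⁻¹ • (x' - y))])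
      (by linarith [(Nat.cast_nonneg n : (0 : ℝ) ≤ n)])
  -- Since `k t x` has integral zero, the constant `k s x' x` may be subtracted from the other
  -- kernel.
  have e : ∫ y, k t x y * starRingEnd ℂ (k s x' y)
      = ∫ y, k t x y * starRingEnd ℂ (k s x' y - k s x' x) := by
    simp_rw [map_sub, mul_sub]
    rw [integral_sub hint ((hk.integrable ht x).mul_const _), integral_mul_const,
      hk.integral_eq_zero t ht x]
    simp
  rw [e]
  refine (enorm_integral_le_lintegral_enorm _).trans ?_
  rw [← lintegral_const_mul _ (by fun_prop)]
  refine lintegral_mono fun y => ?_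
  have b1 := bump_nonneg (r := (n : ℝ) + 1 / 2) hs (x' - y)
  have b2 := bump_nonneg (r := (n : ℝ) + 1 / 2) hs (x' - x)
  have b3 := bump_nonneg (r := (n : ℝ) + 1 / 2) ht (x - y)
  have b4 := bump_nonneg (r := (n : ℝ) + 1) ht (x - y)
  rw [← ENNReal.ofReal_add b1 b2, ← ENNReal.ofReal_mul b3, ← ENNReal.ofReal_mul (by positivity),
    ← ofReal_norm]
  refine ENNReal.ofReal_le_ofReal ?_
  rw [norm_mul, RCLike.norm_conj]
  -- The factor `√(t / s)` is the gain; the factor `√(‖x - y‖ / t)` is absorbed by the decay of `k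
  -- t`.
  have hsplit : √(‖y - x‖ / s) = √(t / s) * √(‖x - y‖ / t) := by
    rw [← Real.sqrt_mul (by positivity), norm_sub_rev]
    congr 1
    field_simp
  have hw := sqrt_mul_bump_le (r := (n : ℝ) + 1 / 2) ht (x - y)
  rw [show (n : ℝ) + 1 / 2 + 1 / 2 = n + 1 by ring] at hw
  calc ‖k t x y‖ * ‖k s x' y - k s x' x‖
      ≤ (B * bump ((n : ℝ) + 1) t (x - y)) * (2 * B * √(‖y - x‖ / s) *
        (bump ((n : ℝ) + 1 / 2) s (x' - y) + bump ((n : ℝ) + 1 / 2) s (x' - x))) :=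
        mul_le_mul (hk.norm_le t ht x y) (hk.holder hs x' y x) (norm_nonneg _) (by positivity)
    _ = 2 * B ^ 2 * √(t / s) * ((√(‖x - y‖ / t) * bump ((n : ℝ) + 1) t (x - y)) *
        (bump ((n : ℝ) + 1 / 2) s (x' - y) + bump ((n : ℝ) + 1 / 2) s (x' - x))) := by
        rw [hsplit]; ring
    _ ≤ _ := by gcongr

theorem lintegral_bump_mul_bump {r t s : ℝ} (ht : 0 < t) (hs : 0 < s) (x : E n) :
    ∫⁻ x', ∫⁻ y, ENNReal.ofReal (bump r t (x - y)) *
        (ENNReal.ofReal (bump r s (x' - y)) + ENNReal.ofReal (bump r s (x' - x)))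
      = 2 * bumpMass n r ^ 2 := by
  rw [lintegral_lintegral_swap (by fun_prop)]
  have : ∀ y : E n, ∫⁻ x', ENNReal.ofReal (bump r t (x - y)) *
        (ENNReal.ofReal (bump r s (x' - y)) + ENNReal.ofReal (bump r s (x' - x)))
      = ENNReal.ofReal (bump r t (x - y)) * (2 * bumpMass n r) := by
    intro y
    rw [lintegral_const_mul _ (by fun_prop), lintegral_add_left (by fun_prop),
      lintegral_bump_sub_right hs, lintegral_bump_sub_right hs, two_mul]
  simp_rw [this]
  rw [lintegral_mul_const _ (by fun_prop), lintegral_bump_sub_left ht]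
  ring

/-- The companion for the case in which the cancellation comes from the kernel based at `x'`, while
the integration is still over `x'`. -/
theorem lintegral_bump_mul_bump' {r t s : ℝ} (ht : 0 < t) (hs : 0 < s) (x : E n) :
    ∫⁻ x', ∫⁻ y, ENNReal.ofReal (bump r s (x' - y)) *
        (ENNReal.ofReal (bump r t (x - y)) + ENNReal.ofReal (bump r t (x - x')))
      = 2 * bumpMass n r ^ 2 := by
  have h1 : ∀ x' : E n, ∫⁻ y, ENNReal.ofReal (bump r s (x' - y)) *
        (ENNReal.ofReal (bump r t (x - y)) + ENNReal.ofReal (bump r t (x - x')))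
      = (∫⁻ y, ENNReal.ofReal (bump r s (x' - y)) * ENNReal.ofReal (bump r t (x - y))) +
        bumpMass n r * ENNReal.ofReal (bump r t (x - x')) := by
    intro x'
    simp_rw [mul_add]
    rw [lintegral_add_left (by fun_prop), lintegral_mul_const _ (by fun_prop),
      lintegral_bump_sub_left hs]
  simp_rw [h1]
  rw [lintegral_add_right _ (by fun_prop), lintegral_const_mul _ (by fun_prop),
    lintegral_bump_sub_left ht, lintegral_lintegral_swap (by fun_prop)]
  have h2 : ∀ y : E n, ∫⁻ x', ENNReal.ofReal (bump r s (x' - y)) * ENNReal.ofReal (bump r t (x - y))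
      = bumpMass n r * ENNReal.ofReal (bump r t (x - y)) := by
    intro y
    rw [lintegral_mul_const _ (by fun_prop), lintegral_bump_sub_right hs]
  simp_rw [h2]
  rw [lintegral_const_mul _ (by fun_prop), lintegral_bump_sub_left ht]
  ring

/-- The cancellation may be taken from either of the two kernels. Using that of `k t` gains `√(t /
s)`; conjugating and using that of `k s` gains `√(s / t)`. -/
theorem lintegral_enorm_integral_mul_conj_le (hk : IsSquareKernel k B) {t s : ℝ} (ht : 0 < t)
    (hs : 0 < s) (x : E n) :
    ∫⁻ x', ‖∫ y, k t x y * starRingEnd ℂ (k s x' y)‖ₑ ≤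
      ENNReal.ofReal (4 * B ^ 2) * bumpMass n ((n : ℝ) + 1 / 2) ^ 2 *
        ENNReal.ofReal (min (√(t / s)) (√(s / t))) := by
  have hsym : ∀ x', ‖∫ y, k t x y * starRingEnd ℂ (k s x' y)‖ₑ
      = ‖∫ y, k s x' y * starRingEnd ℂ (k t x y)‖ₑ := by
    intro x'
    rw [← RCLike.enorm_conj, ← integral_conj]
    simp_rw [map_mul, RingHomCompTriple.comp_apply, RingHom.id_apply]
    simp_rw [mul_comm]
  have hc : ∀ w : ℝ, 0 ≤ w → ENNReal.ofReal (2 * B ^ 2 * w) *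
      (2 * bumpMass n ((n : ℝ) + 1 / 2) ^ 2) =
      ENNReal.ofReal (4 * B ^ 2) * bumpMass n ((n : ℝ) + 1 / 2) ^ 2 * ENNReal.ofReal w := by
    intro w hw
    rw [show 4 * B ^ 2 = 2 * B ^ 2 * 2 by ring, ENNReal.ofReal_mul (by positivity),
      ENNReal.ofReal_mul (p := 2 * B ^ 2) (by positivity)]
    simp only [ENNReal.ofReal_ofNat]
    ring
  have hmeas : ∀ t s : ℝ, Measurable fun z : E n × E n =>
      ENNReal.ofReal (bump ((n : ℝ) + 1 / 2) t (x - z.2)) *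
        (ENNReal.ofReal (bump ((n : ℝ) + 1 / 2) s (z.1 - z.2)) +
          ENNReal.ofReal (bump ((n : ℝ) + 1 / 2) s (z.1 - x))) := fun t s => by fun_prop
  have hmeas' : ∀ t s : ℝ, Measurable fun z : E n × E n =>
      ENNReal.ofReal (bump ((n : ℝ) + 1 / 2) s (z.1 - z.2)) *
        (ENNReal.ofReal (bump ((n : ℝ) + 1 / 2) t (x - z.2)) +
          ENNReal.ofReal (bump ((n : ℝ) + 1 / 2) t (x - z.1))) := fun t s => by fun_prop
  rcases min_cases (√(t / s)) (√(s / t)) with ⟨h, -⟩ | ⟨h, -⟩ <;> rw [h, ← hc _ (by positivity)]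
  · rw [← lintegral_bump_mul_bump ht hs x,
      ← lintegral_const_mul _ (hmeas t s).lintegral_prod_right']
    exact lintegral_mono fun x' => hk.enorm_integral_mul_conj_le ht hs x x'
  · rw [← lintegral_bump_mul_bump' ht hs x,
      ← lintegral_const_mul _ (hmeas' t s).lintegral_prod_right']
    refine lintegral_mono fun x' => ?_
    rw [hsym]
    exact hk.enorm_integral_mul_conj_le hs ht x' x

end IsSquareKernel

/-- The gain is integrable for `ds / s` uniformly in `t`: the ranges `s ≤ t` and `s > t` contribute
at most `2` each. This is the Schur bound for `T T*` in the scale variable. -/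
theorem lintegral_inv_mul_min_sqrt_le {t : ℝ} (ht : 0 < t) :
    ∫⁻ s in Set.Ioi 0, ENNReal.ofReal s⁻¹ * ENNReal.ofReal (min (√(t / s)) (√(s / t))) ≤ 4 := by
  rw [← Set.Ioc_union_Ioi_eq_Ioi ht.le,
    lintegral_union measurableSet_Ioi (Set.Ioc_disjoint_Ioi le_rfl)]
  have h1 : ∫⁻ s in Set.Ioc 0 t,
      ENNReal.ofReal s⁻¹ * ENNReal.ofReal (min (√(t / s)) (√(s / t))) ≤ 2 := by
    have hi : IntegrableOn (fun s : ℝ => t ^ (-(1 / 2) : ℝ) * s ^ (-(1 / 2) : ℝ)) (Set.Ioc 0 t) := by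
      have := (intervalIntegral.intervalIntegrable_rpow' (a := 0) (b := t)
        (r := (-(1 / 2) : ℝ)) (by norm_num)).const_mul (t ^ (-(1 / 2) : ℝ))
      exact (intervalIntegrable_iff_integrableOn_Ioc_of_le ht.le).1 this
    calc _ ≤ ∫⁻ s in Set.Ioc 0 t, ENNReal.ofReal (t ^ (-(1 / 2) : ℝ) * s ^ (-(1 / 2) : ℝ)) := by
          refine setLIntegral_mono' measurableSet_Ioc fun s hs => ?_
          have hs0 : 0 < s := hs.1
          rw [← ENNReal.ofReal_mul (by positivity)]
          refine ENNReal.ofReal_le_ofReal ?_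
          calc s⁻¹ * min (√(t / s)) (√(s / t)) ≤ s⁻¹ * √(s / t) := by
                gcongr; exact min_le_right _ _
            _ = _ := by
              rw [Real.sqrt_div hs0.le, Real.sqrt_eq_rpow, Real.sqrt_eq_rpow, Real.rpow_neg ht.le,
                Real.rpow_neg hs0.le]
              have := Real.rpow_pos_of_pos ht (1 / 2)
              have h2 := Real.rpow_pos_of_pos hs0 (1 / 2)
              have h3 : s ^ (1 / 2 : ℝ) * s ^ (1 / 2 : ℝ) = s := by
                rw [← Real.rpow_add hs0]; norm_num
              field_simp
              rw [sq, h3]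
      _ = ENNReal.ofReal (∫ s in Set.Ioc 0 t, t ^ (-(1 / 2) : ℝ) * s ^ (-(1 / 2) : ℝ)) := by
          rw [ofReal_integral_eq_lintegral_ofReal hi]
          filter_upwards [ae_restrict_mem measurableSet_Ioc] with s hs
          have hs0 : 0 < s := hs.1
          positivity
      _ = 2 := by
          rw [integral_const_mul, ← intervalIntegral.integral_of_le ht.le,
            integral_rpow (Or.inl (by norm_num)), Real.zero_rpow (by norm_num), sub_zero,
            mul_div_assoc', ← Real.rpow_add ht]
          norm_num
      _ ≤ 2 := le_rfl
  have h2 : ∫⁻ s in Set.Ioi t,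
      ENNReal.ofReal s⁻¹ * ENNReal.ofReal (min (√(t / s)) (√(s / t))) ≤ 2 := by
    have hi : IntegrableOn (fun s : ℝ => t ^ (1 / 2 : ℝ) * s ^ (-(3 / 2) : ℝ)) (Set.Ioi t) :=
      (integrableOn_Ioi_rpow_of_lt (by norm_num) ht).const_mul _
    calc _ ≤ ∫⁻ s in Set.Ioi t, ENNReal.ofReal (t ^ (1 / 2 : ℝ) * s ^ (-(3 / 2) : ℝ)) := by
          refine setLIntegral_mono' measurableSet_Ioi fun s hs => ?_
          have hs0 : 0 < s := ht.trans hs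
          rw [← ENNReal.ofReal_mul (by positivity)]
          refine ENNReal.ofReal_le_ofReal ?_
          calc s⁻¹ * min (√(t / s)) (√(s / t)) ≤ s⁻¹ * √(t / s) := by
                gcongr; exact min_le_left _ _
            _ = _ := by
              rw [Real.sqrt_div ht.le, Real.sqrt_eq_rpow, Real.sqrt_eq_rpow,
                show (-(3 / 2) : ℝ) = -1 + -(1 / 2) by norm_num, Real.rpow_add hs0,
                Real.rpow_neg_one, Real.rpow_neg hs0.le]
              ring
      _ = ENNReal.ofReal (∫ s in Set.Ioi t, t ^ (1 / 2 : ℝ) * s ^ (-(3 / 2) : ℝ)) := by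
          rw [ofReal_integral_eq_lintegral_ofReal hi]
          filter_upwards [ae_restrict_mem measurableSet_Ioi] with s hs
          have hs0 : 0 < s := ht.trans hs
          positivity
      _ = 2 := by
          rw [integral_const_mul, integral_Ioi_rpow_of_lt (by norm_num) ht, mul_div_assoc',
            mul_neg, ← Real.rpow_add ht]
          norm_num
      _ ≤ 2 := le_rfl
  calc _ ≤ (2 : ℝ≥0∞) + 2 := add_le_add h1 h2
    _ = 4 := by norm_num

/-- The measure `dt / t` on `(0, ∞)`. -/
noncomputable def logMeasure : Measure ℝ :=
  (volume.restrict (Set.Ioi (0 : ℝ))).withDensity fun t => ENNReal.ofReal t⁻¹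

instance : SFinite logMeasure := by unfold logMeasure; infer_instance

theorem lintegral_logMeasure (g : ℝ → ℝ≥0∞) :
    ∫⁻ t, g t ∂logMeasure = ∫⁻ t in Set.Ioi 0, ENNReal.ofReal t⁻¹ * g t := by
  unfold logMeasure
  rw [lintegral_withDensity_eq_lintegral_mul_non_measurable _ (by fun_prop)
    (Filter.Eventually.of_forall fun t => ENNReal.ofReal_lt_top)]
  rfl

theorem lintegral_logMeasure_mono {g h : ℝ → ℝ≥0∞} (hgh : ∀ t, 0 < t → g t ≤ h t) :
    ∫⁻ t, g t ∂logMeasure ≤ ∫⁻ t, h t ∂logMeasure := by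
  rw [lintegral_logMeasure, lintegral_logMeasure]
  refine setLIntegral_mono' measurableSet_Ioi fun t ht => ?_
  gcongr
  exact hgh t ht

theorem logMeasure_Icc_lt_top {a b : ℝ} (ha : 0 < a) : logMeasure (Set.Icc a b) < ∞ := by
  rw [← lintegral_indicator_one measurableSet_Icc, lintegral_logMeasure]
  calc _ ≤ ∫⁻ t in Set.Ioi 0, (Set.Icc a b).indicator (fun _ => ENNReal.ofReal a⁻¹) t := by
        refine lintegral_mono fun t => ?_
        by_cases h : t ∈ Set.Icc a b
        · simp only [h, Set.indicator_of_mem, Pi.one_apply, mul_one]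
          exact ENNReal.ofReal_le_ofReal (inv_anti₀ ha h.1)
        · simp [h]
    _ ≤ ∫⁻ t, (Set.Icc a b).indicator (fun _ => ENNReal.ofReal a⁻¹) t := setLIntegral_le_lintegral _ _
    _ < ∞ := by
        rw [lintegral_indicator_const measurableSet_Icc, Real.volume_Icc]
        exact ENNReal.mul_lt_top ENNReal.ofReal_lt_top ENNReal.ofReal_lt_top

namespace IsSquareKernel
variable {k : ℝ → E n → E n → ℂ} {B : ℝ}

/-- All scales together form one operator from functions of `y` to functions of `(x, t)`, to which
the `T T*` method applies. Restricting to `[a, b]` makes the measure `dt / t` finite, hence the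
qualitative Schur constant finite; the resulting bound does not depend on `a` and `b`. The constant
`16` is `4` from the almost orthogonality times `4` from the integral over scales. -/
theorem truncated_le (hk : IsSquareKernel k B) {a b : ℝ} (ha : 0 < a) {f : E n → ℂ}
    (hf : Measurable f) (hf2 : ∫⁻ y, ‖f y‖ₑ ^ 2 ≠ ∞) :
    ∫⁻ t, (Set.Icc a b).indicator (fun t => ∫⁻ x, ‖∫ y, k t x y * f y‖ₑ ^ 2) t ∂logMeasure ≤
      ENNReal.ofReal (16 * B ^ 2) * bumpMass n ((n : ℝ) + 1 / 2) ^ 2 * ∫⁻ y, ‖f y‖ₑ ^ 2 := by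
  classical
  set c := bumpMass n ((n : ℝ) + 1 / 2) with hc
  have hcfin : c < ∞ := bumpMass_lt_top (by linarith)
  set K : E n × ℝ → E n → ℂ := fun p y => if p.2 ∈ Set.Icc a b then k p.2 p.1 y else 0 with hK
  have hKm : Measurable (Function.uncurry K) := by
    refine Measurable.ite ?_ ?_ measurable_const
    · exact (measurableSet_Icc.preimage (by fun_prop : Measurable fun z : (E n × ℝ) × E n => z.1.2))
    · exact hk.measurable.comp (by fun_prop :
        Measurable fun z : (E n × ℝ) × E n => (z.1.2, z.1.1, z.2))
  have hK0 : ∀ p, p.2 ∉ Set.Icc a b → ∀ y, K p y = 0 := fun p hp y => if_neg hp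
  have hpos : ∀ {t}, t ∈ Set.Icc a b → 0 < t := fun h => ha.trans_le h.1
  have h₁ : ∀ p, ∫⁻ y, ‖K p y‖ₑ ≤ ENNReal.ofReal B * c := by
    intro p
    by_cases h : p.2 ∈ Set.Icc a b
    · simp only [hK, h, if_true]
      exact hk.lintegral_left_le (hpos h) p.1
    · simp [hK0 p h]
  have h₂ : ∀ y, ∫⁻ p, ‖K p y‖ₑ ∂((volume : Measure (E n)).prod logMeasure) ≤
      ENNReal.ofReal B * c * logMeasure (Set.Icc a b) := by
    intro y
    have hm : Measurable fun p => ‖K p y‖ₑ := (hKm.comp measurable_prodMk_right).enorm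
    rw [lintegral_prod_symm _ hm.aemeasurable, ← lintegral_indicator_const measurableSet_Icc]
    refine lintegral_mono fun t => ?_
    by_cases h : t ∈ Set.Icc a b
    · simp only [hK, h, if_true, Set.indicator_of_mem]
      exact hk.lintegral_right_le (hpos h) y
    · simp [hK0 (_, t) h, h]
  set M := ENNReal.ofReal B * c * (1 + logMeasure (Set.Icc a b)) with hM
  have hMtop : M ≠ ∞ := by
    refine (ENNReal.mul_lt_top (ENNReal.mul_lt_top ENNReal.ofReal_lt_top hcfin) ?_).ne
    exact ENNReal.add_lt_top.2 ⟨ENNReal.one_lt_top, logMeasure_Icc_lt_top ha⟩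
  have hB : ∀ p, ∫⁻ q, ‖∫ y, K p y * starRingEnd ℂ (K q y)‖ₑ
      ∂((volume : Measure (E n)).prod logMeasure) ≤ ENNReal.ofReal (16 * B ^ 2) * c ^ 2 := by
    intro p
    by_cases hp : p.2 ∈ Set.Icc a b
    swap
    · simp [hK0 p hp]
    have hp0 := hpos hp
    have hconj : Measurable (starRingEnd ℂ) := Complex.continuous_conj.measurable
    have hm : Measurable fun q => ‖∫ y, K p y * starRingEnd ℂ (K q y)‖ₑ := by
      have : Measurable fun z : (E n × ℝ) × E n => K p z.2 * starRingEnd ℂ (K z.1 z.2) :=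
        ((hKm.comp measurable_prodMk_left).comp measurable_snd).mul (hconj.comp hKm)
      exact this.stronglyMeasurable.integral_prod_right'.measurable.enorm
    rw [lintegral_prod_symm _ hm.aemeasurable]
    calc _ ≤ ∫⁻ s, ENNReal.ofReal (4 * B ^ 2) * c ^ 2 *
          ENNReal.ofReal (min (√(p.2 / s)) (√(s / p.2))) ∂logMeasure := by
          refine lintegral_logMeasure_mono fun s hs => ?_
          by_cases h : s ∈ Set.Icc a b
          · simp only [hK, h, hp, if_true]
            exact hk.lintegral_enorm_integral_mul_conj_le hp0 hs p.1
          · simp [hK0 (_, s) h]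
      _ ≤ ENNReal.ofReal (4 * B ^ 2) * c ^ 2 * 4 := by
          rw [lintegral_const_mul _ (by fun_prop), lintegral_logMeasure]
          gcongr
          exact lintegral_inv_mul_min_sqrt_le hp0
      _ = _ := by
          rw [show 16 * B ^ 2 = 4 * B ^ 2 * 4 by ring, ENNReal.ofReal_mul (p := 4 * B ^ 2) (by positivity)]
          simp only [ENNReal.ofReal_ofNat]
          ring
  have key := lintegral_enorm_sq_le_of_kernel_mul_adjoint hKm hMtop
    (fun p => (h₁ p).trans (le_mul_of_one_le_right' le_self_add))
    (fun y => (h₂ y).trans (mul_le_mul_right le_add_self _)) hB hf hf2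
  refine le_trans (le_of_eq ?_) key
  have hm : Measurable fun p => ‖∫ y, K p y * f y‖ₑ ^ 2 := by
    have : Measurable fun z : (E n × ℝ) × E n => K z.1 z.2 * f z.2 := Measurable.mul hKm (by fun_prop)
    exact this.stronglyMeasurable.integral_prod_right'.measurable.enorm.pow_const 2
  rw [lintegral_prod_symm _ hm.aemeasurable]
  refine lintegral_congr fun t => ?_
  by_cases h : t ∈ Set.Icc a b
  · simp only [h, Set.indicator_of_mem, hK, if_true]
  · simp [hK0 (_, t) h, h]

/-- The square function estimate. -/
theorem lintegral_le (hk : IsSquareKernel k B) {f : E n → ℂ} (hf : Measurable f)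
    (hf2 : ∫⁻ y, ‖f y‖ₑ ^ 2 ≠ ∞) :
    ∫⁻ t, (∫⁻ x, ‖∫ y, k t x y * f y‖ₑ ^ 2) ∂logMeasure ≤
      ENNReal.ofReal (16 * B ^ 2) * bumpMass n ((n : ℝ) + 1 / 2) ^ 2 * ∫⁻ y, ‖f y‖ₑ ^ 2 := by
  set G : ℝ → ℝ≥0∞ := fun t => ∫⁻ x, ‖∫ y, k t x y * f y‖ₑ ^ 2 with hG
  have hGm : Measurable G := by
    have h1 : Measurable fun z : (ℝ × E n) × E n => k z.1.1 z.1.2 z.2 * f z.2 :=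
      (hk.measurable.comp (by fun_prop :
        Measurable fun z : (ℝ × E n) × E n => (z.1.1, z.1.2, z.2))).mul (by fun_prop)
    have h2 : Measurable fun z : ℝ × E n => ‖∫ y, k z.1 z.2 y * f y‖ₑ ^ 2 :=
      h1.stronglyMeasurable.integral_prod_right'.measurable.enorm.pow_const 2
    exact h2.lintegral_prod_right'
  -- Monotone convergence along an exhaustion of `(0, ∞)` removes the truncation.
  set S : ℕ → Set ℝ := fun m => Set.Icc ((m : ℝ) + 1)⁻¹ (m + 1) with hS
  have hmono : Monotone S := by
    intro i j hij
    have : (i : ℝ) ≤ j := by exact_mod_cast hij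
    exact Set.Icc_subset_Icc (inv_anti₀ (by positivity) (by linarith)) (by linarith)
  calc ∫⁻ t, G t ∂logMeasure ≤ ∫⁻ t, ⨆ m, (S m).indicator G t ∂logMeasure := by
        refine lintegral_logMeasure_mono fun t ht => ?_
        obtain ⟨m, hm⟩ := exists_nat_ge (max t t⁻¹)
        have hmem : t ∈ S m := by
          refine ⟨?_, by linarith [le_max_left t t⁻¹]⟩
          exact inv_le_of_inv_le₀ ht (by linarith [le_max_right t t⁻¹])
        refine le_iSup_of_le m ?_
        rw [Set.indicator_of_mem hmem]
    _ = ⨆ m, ∫⁻ t, (S m).indicator G t ∂logMeasure := by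
        refine lintegral_iSup (fun m => hGm.indicator measurableSet_Icc) ?_
        intro i j hij t
        exact Set.indicator_le_indicator_of_subset (hmono hij) (fun _ => zero_le) t
    _ ≤ _ := iSup_le fun m => hk.truncated_le (by positivity) hf hf2

end IsSquareKernel
end
end WaveletCommutator

/-! ### Size, regularity and cancellation of the commutator kernel -/

namespace WaveletCommutator
section
variable {n : ℕ}

/-- The `L¹`-normalized dilation `t ^ (-n) ψ (u / t)`. -/
noncomputable def meanDilation (ψ : E n → ℂ) (t : ℝ) (u : E n) : ℂ := ((t ^ n)⁻¹ : ℝ) • ψ (t⁻¹ • u)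

/-- The radius keeps `1 + ‖V‖` above a quarter of `1 + ‖U‖`. The fraction `3/4` fits the regularity
estimate below, where a shift by `1/2` and a displacement of at most `‖U‖ / 2 + 1/4` add up to at
most `3/4 * (1 + ‖U‖)`. -/
theorem decay_le_of_near {r : ℝ} (hr : 0 ≤ r) {U V : E n} (hV : ‖V - U‖ ≤ 3 / 4 * (1 + ‖U‖)) :
    (1 + ‖V‖) ^ (-r) ≤ 4 ^ r * (1 + ‖U‖) ^ (-r) := by
  have h1 : (1 + ‖U‖) / 4 ≤ 1 + ‖V‖ := by
    have := norm_sub_norm_le U V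
    rw [norm_sub_rev] at this
    linarith
  calc (1 + ‖V‖) ^ (-r) ≤ ((1 + ‖U‖) / 4) ^ (-r) :=
        Real.rpow_le_rpow_of_nonpos (by positivity) h1 (by linarith)
    _ = _ := by
        rw [Real.div_rpow (by positivity) (by norm_num), Real.rpow_neg (by norm_num : (0 : ℝ) ≤ 4)]
        field_simp

/-- Mean value inequality on a ball over which the decay is comparable to that at the centre. The
target `F` is general so that it applies both to `ψ` and to its derivative. -/
theorem norm_sub_le_of_norm_fderiv_le_decay {F : Type*} [NormedAddCommGroup F] [NormedSpace ℝ F]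
    {G : E n → F} {A r : ℝ} (hr : 0 ≤ r) (hG : Differentiable ℝ G)
    (hG' : ∀ x, ‖fderiv ℝ G x‖ ≤ A * (1 + ‖x‖) ^ (-r)) {U P Q : E n}
    (hP : ‖P - U‖ ≤ 3 / 4 * (1 + ‖U‖)) (hQ : ‖Q - U‖ ≤ 3 / 4 * (1 + ‖U‖)) :
    ‖G P - G Q‖ ≤ A * 4 ^ r * (1 + ‖U‖) ^ (-r) * ‖P - Q‖ := by
  have hA : 0 ≤ A := by simpa using (norm_nonneg _).trans (hG' 0)
  refine Convex.norm_image_sub_le_of_norm_fderiv_le (𝕜 := ℝ)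
    (s := Metric.closedBall U (3 / 4 * (1 + ‖U‖))) (fun x _ => hG x) (fun V hV => ?_)
    (convex_closedBall _ _) (by rwa [mem_closedBall_iff_norm]) (by rwa [mem_closedBall_iff_norm])
  rw [mem_closedBall_iff_norm] at hV
  refine (hG' V).trans ?_
  rw [mul_assoc]
  exact mul_le_mul_of_nonneg_left (decay_le_of_near hr hV) hA

/-- A displacement `τ x - τ y` is only bounded by a multiple of `‖x - y‖`; one power of decay pays
for this growth, which is why `n + 2` turns into `n + 1`. -/
theorem decay_add_two_mul_norm_le (U : E n) :
    (1 + ‖U‖) ^ (-((n : ℝ) + 2)) * ‖U‖ ≤ (1 + ‖U‖) ^ (-((n : ℝ) + 1)) := by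
  have h : 0 < 1 + ‖U‖ := by positivity
  calc _ ≤ (1 + ‖U‖) ^ (-((n : ℝ) + 2)) * (1 + ‖U‖) ^ (1 : ℝ) := by
        rw [Real.rpow_one]; gcongr; linarith
    _ = _ := by rw [← Real.rpow_add h]; congr 1; ring

theorem decay_add_two_le (U : E n) :
    (1 + ‖U‖) ^ (-((n : ℝ) + 2)) ≤ (1 + ‖U‖) ^ (-((n : ℝ) + 1)) :=
  Real.rpow_le_rpow_of_exponent_le (by linarith [norm_nonneg U]) (by linarith)

namespace IsDecayingWavelet
variable {ψ : E n → ℂ} {A : ℝ}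

theorem nonneg (h : IsDecayingWavelet ψ A) : 0 ≤ A := by
  simpa using (norm_nonneg _).trans (h.norm_le 0)

theorem norm_sub_le (h : IsDecayingWavelet ψ A) {U P Q : E n}
    (hP : ‖P - U‖ ≤ 3 / 4 * (1 + ‖U‖)) (hQ : ‖Q - U‖ ≤ 3 / 4 * (1 + ‖U‖)) :
    ‖ψ P - ψ Q‖ ≤ A * 4 ^ ((n : ℝ) + 2) * (1 + ‖U‖) ^ (-((n : ℝ) + 2)) * ‖P - Q‖ :=
  norm_sub_le_of_norm_fderiv_le_decay (by positivity) h.differentiable h.norm_fderiv_le hP hQ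

theorem norm_fderiv_sub_le (h : IsDecayingWavelet ψ A) {U P Q : E n}
    (hP : ‖P - U‖ ≤ 3 / 4 * (1 + ‖U‖)) (hQ : ‖Q - U‖ ≤ 3 / 4 * (1 + ‖U‖)) :
    ‖fderiv ℝ ψ P - fderiv ℝ ψ Q‖ ≤
      A * 4 ^ ((n : ℝ) + 2) * (1 + ‖U‖) ^ (-((n : ℝ) + 2)) * ‖P - Q‖ :=
  norm_sub_le_of_norm_fderiv_le_decay (by positivity) h.differentiable_fderiv
    h.norm_fderiv_fderiv_le hP hQ

theorem norm_le_of_near (h : IsDecayingWavelet ψ A) {U V : E n}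
    (hV : ‖V - U‖ ≤ 3 / 4 * (1 + ‖U‖)) :
    ‖ψ V‖ ≤ A * 4 ^ ((n : ℝ) + 2) * (1 + ‖U‖) ^ (-((n : ℝ) + 2)) := by
  rw [mul_assoc]
  exact (h.norm_le V).trans
    (mul_le_mul_of_nonneg_left (decay_le_of_near (by positivity) hV) h.nonneg)

theorem norm_sub_translate_le (h : IsDecayingWavelet ψ A) {U D : E n} (hD : ‖D‖ ≤ ‖U‖ / 2) :
    ‖ψ U - ψ (U - D)‖ ≤ A * 4 ^ ((n : ℝ) + 2) * (1 + ‖U‖) ^ (-((n : ℝ) + 2)) * ‖D‖ := by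
  have := h.norm_sub_le (U := U) (P := U) (Q := U - D) (by simp; positivity)
    (by simp only [sub_sub_cancel_left, norm_neg]; linarith [norm_nonneg U])
  simpa using this

/-- The size of the kernel of the commutator. -/
theorem norm_sub_smul_le (h : IsDecayingWavelet ψ A) {U D : E n} {j α γ : ℝ} (hα0 : 0 ≤ α) (hα : α ≤ 1 / 2)
    (hD : ‖D‖ ≤ α * ‖U‖) (hj : |1 - j| ≤ γ) :
    ‖ψ U - j • ψ (U - D)‖ ≤
      A * 4 ^ ((n : ℝ) + 2) * (α + γ) * (1 + ‖U‖) ^ (-((n : ℝ) + 1)) := by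
  have hA := h.nonneg
  have hU := norm_nonneg U
  have hD2 : ‖D‖ ≤ ‖U‖ / 2 := hD.trans (by nlinarith)
  have hγ : 0 ≤ γ := (abs_nonneg _).trans hj
  have e : ψ U - j • ψ (U - D) = (ψ U - ψ (U - D)) + (1 - j) • ψ (U - D) := by
    rw [sub_smul, one_smul]; ring
  rw [e]
  calc _ ≤ ‖ψ U - ψ (U - D)‖ + ‖(1 - j) • ψ (U - D)‖ := norm_add_le _ _
    _ ≤ A * 4 ^ ((n : ℝ) + 2) * (1 + ‖U‖) ^ (-((n : ℝ) + 2)) * (α * ‖U‖) +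
        γ * (A * 4 ^ ((n : ℝ) + 2) * (1 + ‖U‖) ^ (-((n : ℝ) + 2))) := by
        refine add_le_add ((h.norm_sub_translate_le hD2).trans (by gcongr)) ?_
        rw [norm_smul]
        refine mul_le_mul hj (h.norm_le_of_near ?_) (norm_nonneg _) hγ
        simp only [sub_sub_cancel_left, norm_neg]
        linarith
    _ = A * 4 ^ ((n : ℝ) + 2) * (α * ((1 + ‖U‖) ^ (-((n : ℝ) + 2)) * ‖U‖) +
        γ * (1 + ‖U‖) ^ (-((n : ℝ) + 2))) := by ring
    _ ≤ A * 4 ^ ((n : ℝ) + 2) * (α * (1 + ‖U‖) ^ (-((n : ℝ) + 1)) +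
        γ * (1 + ‖U‖) ^ (-((n : ℝ) + 1))) := by
        have h1 := decay_add_two_mul_norm_le U
        have h2 := decay_add_two_le U
        gcongr
    _ = _ := by ring

/-- The regularity of the kernel of the commutator. -/
theorem norm_sub_smul_sub_le (h : IsDecayingWavelet ψ A) {U U' D D' : E n} {j j' α β γ ε : ℝ}
    (hα0 : 0 ≤ α) (hα : α ≤ 1 / 2) (hε : ε ≤ 1 / 2) (hU : ‖U - U'‖ ≤ ε) (hD : ‖D‖ ≤ α * ‖U‖)
    (hD' : ‖D'‖ ≤ α * ‖U'‖) (hDD : ‖D - D'‖ ≤ α * ε) (hj : |1 - j| ≤ γ)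
    (hjj : |j - j'| ≤ β * ε) :
    ‖(ψ U - j • ψ (U - D)) - (ψ U' - j' • ψ (U' - D'))‖ ≤
      A * 4 ^ ((n : ℝ) + 2) * (2 * α + 2 * γ + β) * ε * (1 + ‖U‖) ^ (-((n : ℝ) + 1)) := by
  have hA := h.nonneg
  have hUn := norm_nonneg U
  have hε0 : 0 ≤ ε := (norm_nonneg _).trans hU
  have hγ : 0 ≤ γ := (abs_nonneg _).trans hj
  have hU2 : ‖U' - U‖ ≤ 1 / 2 := by rw [norm_sub_rev]; linarith
  have hU'n : ‖U'‖ ≤ ‖U‖ + 1 / 2 := by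
    have := norm_sub_norm_le U' U
    linarith
  have hD2 : ‖D‖ ≤ ‖U‖ / 2 := hD.trans (by nlinarith)
  have hD'2 : ‖D'‖ ≤ ‖U‖ / 2 + 1 / 4 := hD'.trans (by nlinarith [norm_nonneg U'])
  have n1 : ‖U - D - U‖ ≤ 3 / 4 * (1 + ‖U‖) := by
    simp only [sub_sub_cancel_left, norm_neg]; linarith
  have n2 : ∀ V : E n, ‖V - U‖ ≤ 1 / 2 → ‖V - D - U‖ ≤ 3 / 4 * (1 + ‖U‖) := fun V hV => by
    rw [show V - D - U = (V - U) - D by abel]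
    have := _root_.norm_sub_le (V - U) D
    linarith
  have n3 : ‖U' - D' - U‖ ≤ 3 / 4 * (1 + ‖U‖) := by
    rw [show U' - D' - U = (U' - U) - D' by abel]
    have := _root_.norm_sub_le (U' - U) D'
    linarith
  set w := A * 4 ^ ((n : ℝ) + 2) * (1 + ‖U‖) ^ (-((n : ℝ) + 2)) with hw
  have hw0 : 0 ≤ w := by positivity
  -- Mean value inequality for `V ↦ ψ V - ψ (V - D)` with `D` frozen. Its derivative is a difference
  -- of values of `fderiv ℝ ψ`, so the second derivative of `ψ` supplies the factor `α * ‖U‖` in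
  -- addition to `ε`.
  have t1 : ‖(ψ U - ψ (U - D)) - (ψ U' - ψ (U' - D))‖ ≤ w * (α * ‖U‖) * ε := by
    have hd : Differentiable ℝ fun V : E n => ψ (V - D) :=
      h.differentiable.comp (differentiable_id.sub_const D)
    have hf : ∀ V, fderiv ℝ (fun V => ψ V - ψ (V - D)) V
        = fderiv ℝ ψ V - fderiv ℝ ψ (V - D) := fun V => by
      rw [fderiv_fun_sub (h.differentiable V) (hd V), fderiv_comp_sub]
    have := Convex.norm_image_sub_le_of_norm_fderiv_le (𝕜 := ℝ) (f := fun V => ψ V - ψ (V - D))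
      (C := w * (α * ‖U‖)) (s := Metric.closedBall U (1 / 2)) (x := U') (y := U)
      (fun V _ => (h.differentiable V).sub (hd V)) (fun V hV => ?_) (convex_closedBall _ _)
      (by rwa [mem_closedBall_iff_norm]) (by simp)
    · exact this.trans (by gcongr)
    · rw [mem_closedBall_iff_norm] at hV
      rw [hf]
      refine (h.norm_fderiv_sub_le (U := U) (by linarith) (n2 V hV)).trans ?_
      rw [← hw]
      gcongr
      simpa using hD
  have t2 : ‖ψ (U' - D') - ψ (U' - D)‖ ≤ w * (α * ε) := by
    refine (h.norm_sub_le n3 (n2 U' hU2)).trans ?_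
    rw [← hw, show U' - D' - (U' - D) = D - D' by abel]
    gcongr
  have t3 : ‖(1 - j) • (ψ (U - D) - ψ (U' - D'))‖ ≤ γ * (w * (2 * ε)) := by
    rw [norm_smul]
    refine mul_le_mul hj ((h.norm_sub_le n1 n3).trans ?_) (norm_nonneg _) hγ
    rw [← hw, show U - D - (U' - D') = (U - U') - (D - D') by abel]
    gcongr
    refine (_root_.norm_sub_le _ _).trans ?_
    nlinarith
  have t4 : ‖(j - j') • ψ (U' - D')‖ ≤ β * ε * w := by
    rw [norm_smul]
    exact mul_le_mul hjj (h.norm_le_of_near n3) (norm_nonneg _) ((abs_nonneg _).trans hjj)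
  have hβ : 0 ≤ β * ε := (abs_nonneg _).trans hjj
  -- The change of base point with `D` fixed, the change of `D`, and the two effects of the Jacobian
  -- (its distance to `1` and its variation) are separated.
  have e : (ψ U - j • ψ (U - D)) - (ψ U' - j' • ψ (U' - D'))
      = ((ψ U - ψ (U - D)) - (ψ U' - ψ (U' - D))) + (ψ (U' - D') - ψ (U' - D)) +
        (1 - j) • (ψ (U - D) - ψ (U' - D')) - (j - j') • ψ (U' - D') := by
    simp only [Complex.real_smul, Complex.ofReal_sub, Complex.ofReal_one]
    ring
  have hw1 : w * ‖U‖ ≤ A * 4 ^ ((n : ℝ) + 2) * (1 + ‖U‖) ^ (-((n : ℝ) + 1)) := by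
    rw [hw, mul_assoc]
    exact mul_le_mul_of_nonneg_left (decay_add_two_mul_norm_le U) (by positivity)
  have hw2 : w ≤ A * 4 ^ ((n : ℝ) + 2) * (1 + ‖U‖) ^ (-((n : ℝ) + 1)) :=
    mul_le_mul_of_nonneg_left (decay_add_two_le U) (by positivity)
  rw [e]
  calc _ ≤ w * (α * ‖U‖) * ε + w * (α * ε) + γ * (w * (2 * ε)) + β * ε * w :=
        norm_sub_le_of_le (norm_add_le_of_le (norm_add_le_of_le t1 t2) t3) t4
    _ = (w * ‖U‖) * (α * ε) + w * (α * ε + 2 * γ * ε + β * ε) := by ring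
    _ ≤ (A * 4 ^ ((n : ℝ) + 2) * (1 + ‖U‖) ^ (-((n : ℝ) + 1))) * (α * ε) +
        (A * 4 ^ ((n : ℝ) + 2) * (1 + ‖U‖) ^ (-((n : ℝ) + 1))) *
          (α * ε + 2 * γ * ε + β * ε) := by gcongr
    _ = _ := by ring

theorem measurable (h : IsDecayingWavelet ψ A) : Measurable ψ :=
  h.differentiable.continuous.measurable

theorem integral_meanDilation (h : IsDecayingWavelet ψ A) (t : ℝ) :
    ∫ u, meanDilation ψ t u = 0 := by
  unfold meanDilation
  rw [integral_smul, Measure.integral_comp_smul, h.integral_eq_zero]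
  simp

theorem measurable_meanDilation (h : IsDecayingWavelet ψ A) {α : Type*} [MeasurableSpace α]
    {t : α → ℝ} {u : α → E n} (ht : Measurable t) (hu : Measurable u) :
    Measurable fun a => meanDilation ψ (t a) (u a) := by
  unfold meanDilation
  exact (by fun_prop : Measurable fun a => (t a ^ n)⁻¹).smul
    (h.measurable.comp (by fun_prop : Measurable fun a => (t a)⁻¹ • u a))

theorem norm_meanDilation_le (h : IsDecayingWavelet ψ A) {t : ℝ} (ht : 0 < t) (u : E n) :
    ‖meanDilation ψ t u‖ ≤ A * bump ((n : ℝ) + 2) t u := by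
  unfold meanDilation bump
  rw [norm_smul, Real.norm_of_nonneg (by positivity), mul_left_comm]
  gcongr
  exact h.norm_le _

/-- The kernel of the wavelet transform. -/
theorem isSquareKernel (h : IsDecayingWavelet ψ A) :
    IsSquareKernel (fun t x y => meanDilation ψ t (x - y)) (A * 4 ^ ((n : ℝ) + 2)) where
  measurable := h.measurable_meanDilation (by fun_prop) (by fun_prop)
  norm_le t ht x y := by
    refine (h.norm_meanDilation_le ht _).trans ?_
    have h1 : (1 : ℝ) ≤ 4 ^ ((n : ℝ) + 2) := Real.one_le_rpow (by norm_num) (by positivity)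
    refine mul_le_mul (le_mul_of_one_le_right h.nonneg h1) (bump_anti ht (by linarith) _)
      (bump_nonneg ht _) (by have := h.nonneg; positivity)
  norm_sub_le t ht x y y' hy := by
    have hA := h.nonneg
    unfold meanDilation bump
    rw [← smul_sub, norm_smul, Real.norm_of_nonneg (by positivity), mul_left_comm]
    have hUU : t⁻¹ • (x - y) - t⁻¹ • (x - y') = t⁻¹ • (y' - y) := by
      rw [← smul_sub]; congr 1; abel
    have hn : ‖t⁻¹ • (y' - y)‖ = ‖y - y'‖ / t := by
      rw [norm_smul, Real.norm_of_nonneg (by positivity), norm_sub_rev, div_eq_inv_mul]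
    have he : ‖y - y'‖ / t ≤ 1 / 2 := by rw [div_le_iff₀ ht]; linarith
    have hU0 := norm_nonneg (t⁻¹ • (x - y))
    have := h.norm_sub_le (U := t⁻¹ • (x - y)) (P := t⁻¹ • (x - y)) (Q := t⁻¹ • (x - y'))
      (by simp; positivity) (by rw [norm_sub_rev, hUU, hn]; linarith)
    rw [hUU, hn] at this
    gcongr
    refine this.trans ?_
    calc _ = A * 4 ^ ((n : ℝ) + 2) * (‖y - y'‖ / t) *
          (1 + ‖t⁻¹ • (x - y)‖) ^ (-((n : ℝ) + 2)) := by ring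
      _ ≤ _ := mul_le_mul_of_nonneg_left (decay_add_two_le _) (by positivity)
  integral_eq_zero t _ x := by
    rw [integral_sub_left_eq_self (fun u => meanDilation ψ t u), h.integral_meanDilation]

end IsDecayingWavelet

/-- The kernel of the commutator at scale `t` after a change of variables with Jacobian `j`. -/
noncomputable def commKernel (ψ : E n → ℂ) (τ : E n → E n) (j : E n → ℝ) (t : ℝ) (x y : E n) : ℂ :=
  meanDilation ψ t (x - y) - j y • meanDilation ψ t ((x - τ x) - (y - τ y))

theorem commKernel_eq (ψ : E n → ℂ) (τ : E n → E n) (j : E n → ℝ) (t : ℝ) (x y : E n) :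
    commKernel ψ τ j t x y = ((t ^ n)⁻¹ : ℝ) • (ψ (t⁻¹ • (x - y)) -
      j y • ψ (t⁻¹ • (x - y) - t⁻¹ • (τ x - τ y))) := by
  unfold commKernel meanDilation
  rw [smul_comm (j y), ← smul_sub, ← smul_sub]
  congr 5
  abel

/-- Bounds on a deformation `τ` and on the Jacobian `j` of `y ↦ y - τ y`. -/
structure HasDeformationBounds (τ : E n → E n) (j : E n → ℝ) (α β γ : ℝ) : Prop where
  measurable : Measurable τ
  measurable_jacobian : Measurable j
  nonneg : 0 ≤ α
  le_half : α ≤ 1 / 2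
  norm_sub_le : ∀ x y, ‖τ x - τ y‖ ≤ α * ‖x - y‖
  abs_one_sub_le : ∀ y, |1 - j y| ≤ γ
  abs_sub_le : ∀ y y', |j y - j y'| ≤ β * ‖y - y'‖
  change_of_variables : ∀ g : E n → ℂ, ∫ y, j y • g (y - τ y) = ∫ z, g z

namespace HasDeformationBounds
variable {ψ : E n → ℂ} {A : ℝ} {τ : E n → E n} {j : E n → ℝ} {α β γ : ℝ}

theorem norm_smul_sub_le (hτ : HasDeformationBounds τ j α β γ) (t : ℝ) (x y : E n) :
    ‖t⁻¹ • (τ x - τ y)‖ ≤ α * ‖t⁻¹ • (x - y)‖ := by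
  rw [norm_smul, norm_smul, mul_left_comm]
  gcongr
  exact hτ.norm_sub_le x y

theorem jacobian_bound_nonneg (hτ : HasDeformationBounds τ j α β γ) : 0 ≤ γ :=
  (abs_nonneg _).trans (hτ.abs_one_sub_le 0)

theorem measurable_commKernel (hτ : HasDeformationBounds τ j α β γ) (h : IsDecayingWavelet ψ A) :
    Measurable fun z : ℝ × E n × E n => commKernel ψ τ j z.1 z.2.1 z.2.2 := by
  have hm := hτ.measurable
  have hj := hτ.measurable_jacobian
  unfold commKernel
  exact (h.measurable_meanDilation (by fun_prop) (by fun_prop)).sub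
    ((by fun_prop : Measurable fun z : ℝ × E n × E n => j z.2.2).smul
      (h.measurable_meanDilation (by fun_prop) (by fun_prop)))

theorem norm_commKernel_le (hτ : HasDeformationBounds τ j α β γ) (h : IsDecayingWavelet ψ A)
    {t : ℝ} (ht : 0 < t) (x y : E n) :
    ‖commKernel ψ τ j t x y‖ ≤
      A * 4 ^ ((n : ℝ) + 2) * (α + γ) * bump ((n : ℝ) + 1) t (x - y) := by
  rw [commKernel_eq, norm_smul, Real.norm_of_nonneg (by positivity)]
  unfold bump
  rw [mul_left_comm]
  gcongr
  exact h.norm_sub_smul_le hτ.nonneg hτ.le_half (hτ.norm_smul_sub_le t x y)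
    (hτ.abs_one_sub_le y)

/-- The Jacobian varies at unit scale rather than at scale `t`: its variation `β * ‖y - y'‖` is at
most `β * ‖y - y'‖ / t` because `t ≤ 1`. The other terms scale correctly for every `t`. -/
theorem norm_commKernel_sub_le (hτ : HasDeformationBounds τ j α β γ) (hβ : 0 ≤ β)
    (h : IsDecayingWavelet ψ A) {t : ℝ} (ht : 0 < t) (ht1 : t ≤ 1) (x y y' : E n)
    (hy : ‖y - y'‖ ≤ t / 2) :
    ‖commKernel ψ τ j t x y - commKernel ψ τ j t x y'‖ ≤
      A * 4 ^ ((n : ℝ) + 2) * (2 * α + 2 * γ + β) * (‖y - y'‖ / t) *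
        bump ((n : ℝ) + 1) t (x - y) := by
  rw [commKernel_eq, commKernel_eq, ← smul_sub, norm_smul, Real.norm_of_nonneg (by positivity)]
  unfold bump
  rw [mul_left_comm]
  have hn : ∀ v : E n, ‖t⁻¹ • v‖ = ‖v‖ / t := fun v => by
    rw [norm_smul, Real.norm_of_nonneg (by positivity), div_eq_inv_mul]
  have he : ‖y - y'‖ / t ≤ 1 / 2 := by rw [div_le_iff₀ ht]; linarith
  gcongr
  refine h.norm_sub_smul_sub_le hτ.nonneg hτ.le_half he ?_ (hτ.norm_smul_sub_le t x y)
    (hτ.norm_smul_sub_le t x y') ?_ (hτ.abs_one_sub_le y) ?_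
  · rw [← smul_sub, hn, sub_sub_sub_cancel_left, norm_sub_rev]
  · rw [← smul_sub, hn, sub_sub_sub_cancel_left, norm_sub_rev, ← mul_div_assoc]
    gcongr
    exact hτ.norm_sub_le y y'
  · refine (hτ.abs_sub_le y y').trans ?_
    gcongr
    exact le_div_self (norm_nonneg _) ht ht1

/-- Both terms integrate to zero: the first by translation invariance, the second because the factor
`j` undoes the substitution `z = y - τ y` and leaves a translate of the wavelet. -/
theorem integral_commKernel (hτ : HasDeformationBounds τ j α β γ) (h : IsDecayingWavelet ψ A)
    {t : ℝ} (ht : 0 < t) (x : E n) : ∫ y, commKernel ψ τ j t x y = 0 := by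
  have i1 := h.isSquareKernel.integrable ht x
  have i2 : Integrable fun y => commKernel ψ τ j t x y := by
    have hA := h.nonneg
    have hm : Measurable fun y => commKernel ψ τ j t x y :=
      (hτ.measurable_commKernel h).comp (by fun_prop : Measurable fun y : E n => (t, x, y))
    refine ⟨hm.aestronglyMeasurable, ?_⟩
    have hlt : ∫⁻ y, ENNReal.ofReal (A * 4 ^ ((n : ℝ) + 2) * (α + γ)) *
        ENNReal.ofReal (bump ((n : ℝ) + 1) t (x - y)) < ∞ := by
      rw [lintegral_const_mul _ (by fun_prop), lintegral_bump_sub_left ht]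
      exact ENNReal.mul_lt_top ENNReal.ofReal_lt_top (bumpMass_lt_top (by linarith))
    refine lt_of_le_of_lt (lintegral_mono fun y => ?_) hlt
    have := hτ.nonneg
    have := hτ.jacobian_bound_nonneg
    rw [← ENNReal.ofReal_mul (by positivity), ← ofReal_norm]
    exact ENNReal.ofReal_le_ofReal (hτ.norm_commKernel_le h ht x y)
  have i3 : Integrable fun y => j y • meanDilation ψ t ((x - τ x) - (y - τ y)) := by
    refine (i1.sub i2).congr (Filter.Eventually.of_forall fun y => ?_)
    simp [commKernel]
  unfold commKernel
  rw [integral_sub i1 i3, hτ.change_of_variables fun z => meanDilation ψ t ((x - τ x) - z),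
    h.isSquareKernel.integral_eq_zero t ht x, h.isSquareKernel.integral_eq_zero t ht (x - τ x),
    sub_zero]

/-- The kernel of the commutator at small scales. -/
theorem isSquareKernel_commKernel (hτ : HasDeformationBounds τ j α β γ) (hβ : 0 ≤ β)
    (h : IsDecayingWavelet ψ A) :
    IsSquareKernel (fun t x y => if t ≤ 1 then commKernel ψ τ j t x y else 0)
      (A * 4 ^ ((n : ℝ) + 2) * (2 * α + 2 * γ + β)) where
  measurable := by
    refine Measurable.ite ?_ (hτ.measurable_commKernel h) measurable_const
    exact measurableSet_Iic.preimage measurable_fst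
  norm_le t ht x y := by
    have hA := h.nonneg
    have h1 := hτ.nonneg
    have h2 := hτ.jacobian_bound_nonneg
    have h3 := bump_nonneg (r := (n : ℝ) + 1) ht (x - y)
    split_ifs
    · refine (hτ.norm_commKernel_le h ht x y).trans ?_
      have : α + γ ≤ 2 * α + 2 * γ + β := by linarith
      gcongr
    · rw [norm_zero]; positivity
  norm_sub_le t ht x y y' hy := by
    have hA := h.nonneg
    have h1 := hτ.nonneg
    have h2 := hτ.jacobian_bound_nonneg
    have h3 := bump_nonneg (r := (n : ℝ) + 1) ht (x - y)
    split_ifs with ht1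
    · exact hτ.norm_commKernel_sub_le hβ h ht ht1 x y y' hy
    · rw [sub_zero, norm_zero]; positivity
  integral_eq_zero t ht x := by
    split_ifs
    · exact hτ.integral_commKernel h ht x
    · simp

end HasDeformationBounds
end
end WaveletCommutator

/-! ### Large scales and the square function of the commutator -/

namespace WaveletCommutator
section
variable {n : ℕ}

/-- The source of the logarithm: the minimum is at most `α` up to the crossover `t = D / α`, which
costs `α² log (D / α)`, and at most `D / t` beyond it, where the tail costs at most `α²`. -/
theorem lintegral_inv_mul_min_sq_le {α D : ℝ} (hα : 0 ≤ α) (hD : 0 ≤ D) :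
    ∫⁻ t in Set.Ioi 1, ENNReal.ofReal t⁻¹ * ENNReal.ofReal (min α (D / t) ^ 2) ≤
      ENNReal.ofReal (α ^ 2 * (Real.log (max 1 (D / α)) + 1)) := by
  rcases hα.eq_or_lt with rfl | hα
  · refine le_trans (le_of_eq ?_) zero_le
    rw [setLIntegral_eq_zero measurableSet_Ioi]
    intro t ht
    have ht0 : (0 : ℝ) < t := one_pos.trans ht
    have : min 0 (D / t) = 0 := min_eq_left (by positivity)
    simp [this]
  -- The crossover, clipped to the range of integration; `D ≤ R * α` holds in both cases.
  set R := max 1 (D / α) with hR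
  have hR1 : 1 ≤ R := le_max_left _ _
  have hR0 : 0 < R := by linarith
  rw [← Set.Ioc_union_Ioi_eq_Ioi hR1,
    lintegral_union measurableSet_Ioi (Set.Ioc_disjoint_Ioi le_rfl), mul_add, mul_one,
    ENNReal.ofReal_add (mul_nonneg (sq_nonneg _) (Real.log_nonneg hR1)) (sq_nonneg _)]
  refine add_le_add ?_ ?_
  · have hi : IntegrableOn (fun t : ℝ => α ^ 2 * t⁻¹) (Set.Ioc 1 R) := by
      have : IntervalIntegrable (fun t : ℝ => t⁻¹) volume 1 R := by
        rw [intervalIntegrable_inv_iff]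
        right
        rw [Set.uIcc_of_le hR1]
        simp
      exact (intervalIntegrable_iff_integrableOn_Ioc_of_le hR1).1 (this.const_mul _)
    calc _ ≤ ∫⁻ t in Set.Ioc 1 R, ENNReal.ofReal (α ^ 2 * t⁻¹) := by
          refine setLIntegral_mono' measurableSet_Ioc fun t ht => ?_
          have ht0 : 0 < t := one_pos.trans ht.1
          rw [← ENNReal.ofReal_mul (by positivity), mul_comm]
          refine ENNReal.ofReal_le_ofReal ?_
          gcongr
          exact min_le_left _ _
      _ = ENNReal.ofReal (∫ t in Set.Ioc 1 R, α ^ 2 * t⁻¹) := by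
          rw [ofReal_integral_eq_lintegral_ofReal hi]
          filter_upwards [ae_restrict_mem measurableSet_Ioc] with t ht
          have ht0 : 0 < t := one_pos.trans ht.1
          positivity
      _ ≤ _ := by
          rw [integral_const_mul, ← intervalIntegral.integral_of_le hR1,
            integral_inv_of_pos one_pos hR0, div_one]
  · have hi : IntegrableOn (fun t : ℝ => D ^ 2 * t ^ (-3 : ℝ)) (Set.Ioi R) :=
      (integrableOn_Ioi_rpow_of_lt (by norm_num) hR0).const_mul _
    calc _ ≤ ∫⁻ t in Set.Ioi R, ENNReal.ofReal (D ^ 2 * t ^ (-3 : ℝ)) := by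
          refine setLIntegral_mono' measurableSet_Ioi fun t ht => ?_
          have ht0 : 0 < t := hR0.trans ht
          rw [← ENNReal.ofReal_mul (by positivity)]
          refine ENNReal.ofReal_le_ofReal ?_
          calc t⁻¹ * min α (D / t) ^ 2 ≤ t⁻¹ * (D / t) ^ 2 := by
                gcongr
                exact min_le_right _ _
            _ = _ := by
              rw [Real.rpow_neg ht0.le, show (3 : ℝ) = (3 : ℕ) by norm_num, Real.rpow_natCast]
              field_simp
      _ = ENNReal.ofReal (∫ t in Set.Ioi R, D ^ 2 * t ^ (-3 : ℝ)) := by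
          rw [ofReal_integral_eq_lintegral_ofReal hi]
          filter_upwards [ae_restrict_mem measurableSet_Ioi] with t ht
          have ht0 : 0 < t := hR0.trans ht
          positivity
      _ ≤ _ := by
          refine ENNReal.ofReal_le_ofReal ?_
          rw [integral_const_mul, integral_Ioi_rpow_of_lt (by norm_num) hR0,
            show (-3 : ℝ) + 1 = -(2 : ℕ) by norm_num, Real.rpow_neg hR0.le, Real.rpow_natCast]
          have h1 : D ≤ R * α := by
            rw [← div_le_iff₀ hα]; exact le_max_right _ _
          have h2 : D ^ 2 ≤ (R * α) ^ 2 := by gcongr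
          have h3 : D ^ 2 * (R ^ 2)⁻¹ ≤ α ^ 2 := by
            rw [← div_eq_mul_inv, div_le_iff₀ (by positivity)]
            linarith [mul_pow R α 2, mul_comm (R ^ 2) (α ^ 2)]
          have h4 : 0 ≤ D ^ 2 * (R ^ 2)⁻¹ := by positivity
          have e : D ^ 2 * (-(R ^ 2)⁻¹ / -((2 : ℕ) : ℝ)) = D ^ 2 * (R ^ 2)⁻¹ / 2 := by
            push_cast; ring
          rw [e]
          linarith

/-- A kernel under a bump is both integrable and bounded, so Cauchy-Schwarz with weight `‖κ‖`
reduces the claim to `g ∈ L²`. -/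
theorem integrable_mul_of_le_bump {κ g : E n → ℂ} (hκ : Measurable κ) (hg : Measurable g)
    (hg2 : ∫⁻ y, ‖g y‖ₑ ^ 2 ≠ ∞) {B t : ℝ} (hB : 0 ≤ B) (ht : 0 < t) {x : E n}
    (h : ∀ y, ‖κ y‖ ≤ B * bump ((n : ℝ) + 1) t (x - y)) : Integrable fun y => κ y * g y := by
  refine ⟨(hκ.mul hg).aestronglyMeasurable, ?_⟩
  rw [HasFiniteIntegral]
  simp only [enorm_mul]
  have h1 : ∫⁻ y, ‖κ y‖ₑ < ∞ := by
    have hlt : ∫⁻ y, ENNReal.ofReal B * ENNReal.ofReal (bump ((n : ℝ) + 1) t (x - y)) < ∞ := by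
      rw [lintegral_const_mul _ (by fun_prop), lintegral_bump_sub_left ht]
      exact ENNReal.mul_lt_top ENNReal.ofReal_lt_top (bumpMass_lt_top (by linarith))
    refine lt_of_le_of_lt (lintegral_mono fun y => ?_) hlt
    rw [← ENNReal.ofReal_mul hB, ← ofReal_norm]
    exact ENNReal.ofReal_le_ofReal (h y)
  have h2 : ∀ y, ‖κ y‖ₑ ≤ ENNReal.ofReal (B * (t ^ n)⁻¹) := fun y => by
    rw [← ofReal_norm]
    refine ENNReal.ofReal_le_ofReal ((h y).trans ?_)
    unfold bump
    gcongr
    refine mul_le_of_le_one_right (by positivity) ?_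
    exact Real.rpow_le_one_of_one_le_of_nonpos (by linarith [norm_nonneg (t⁻¹ • (x - y))])
      (by linarith [(Nat.cast_nonneg n : (0 : ℝ) ≤ n)])
  have h3 : ∫⁻ y, ‖κ y‖ₑ * ‖g y‖ₑ ^ 2 < ∞ := by
    refine lt_of_le_of_lt (lintegral_mono fun y => mul_le_mul_left (h2 y) _) ?_
    rw [lintegral_const_mul _ (by fun_prop)]
    exact ENNReal.mul_lt_top ENNReal.ofReal_lt_top hg2.lt_top
  have := (sq_lintegral_mul_le volume hκ.enorm hg.enorm).trans_lt (ENNReal.mul_lt_top h1 h3)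
  exact (ENNReal.pow_lt_top_iff.1 this).resolve_right (by norm_num)

theorem enorm_add_sq_le (z w : ℂ) : ‖z + w‖ₑ ^ 2 ≤ 2 * ‖z‖ₑ ^ 2 + 2 * ‖w‖ₑ ^ 2 := by
  rw [← ofReal_norm, ← ofReal_norm, ← ofReal_norm, ← ENNReal.ofReal_pow (norm_nonneg _),
    ← ENNReal.ofReal_pow (norm_nonneg _), ← ENNReal.ofReal_pow (norm_nonneg _),
    show (2 : ℝ≥0∞) = ENNReal.ofReal 2 by simp, ← ENNReal.ofReal_mul zero_le_two,
    ← ENNReal.ofReal_mul zero_le_two, ← ENNReal.ofReal_add (by positivity) (by positivity)]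
  refine ENNReal.ofReal_le_ofReal ?_
  have := norm_add_le z w
  have h2 : ‖z + w‖ ^ 2 ≤ (‖z‖ + ‖w‖) ^ 2 := by gcongr
  nlinarith [sq_nonneg (‖z‖ - ‖w‖)]

namespace HasDeformationBounds
variable {ψ : E n → ℂ} {A : ℝ} {τ : E n → E n} {j : E n → ℝ} {α β γ D : ℝ}

/-- Without the Jacobian, the kernel of the commutator decays at large scales. -/
theorem lintegral_integral_translate_le (hτ : HasDeformationBounds τ j α β γ)
    (h : IsDecayingWavelet ψ A) (hD : ∀ x y, ‖τ x - τ y‖ ≤ D) {t : ℝ} (ht : 0 < t) {g : E n → ℂ}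
    (hg : Measurable g) :
    ∫⁻ x, ‖∫ y, commKernel ψ τ (fun _ => 1) t x y * g y‖ₑ ^ 2 ≤
      ENNReal.ofReal ((A * 4 ^ ((n : ℝ) + 2)) ^ 2) * bumpMass n ((n : ℝ) + 1) ^ 2 *
        ENNReal.ofReal (min α (D / t) ^ 2) * ∫⁻ y, ‖g y‖ₑ ^ 2 := by
  have hA := h.nonneg
  have hα := hτ.nonneg
  have hD0 : 0 ≤ D := (norm_nonneg _).trans (hD 0 0)
  have hm : Measurable (Function.uncurry fun x y => commKernel ψ τ (fun _ => 1) t x y) := by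
    have := hτ.measurable
    unfold commKernel
    simp only [one_smul]
    exact (h.measurable_meanDilation (by fun_prop) (by fun_prop)).sub
      (h.measurable_meanDilation (by fun_prop) (by fun_prop))
  set q := A * 4 ^ ((n : ℝ) + 2) * min α (D / t) with hq
  have hq0 : 0 ≤ q := by positivity
  have hb : ∀ x y, ‖commKernel ψ τ (fun _ => 1) t x y‖ₑ ≤
      ENNReal.ofReal q * ENNReal.ofReal (bump ((n : ℝ) + 1) t (x - y)) := by
    intro x y
    rw [← ENNReal.ofReal_mul hq0, ← ofReal_norm]
    refine ENNReal.ofReal_le_ofReal ?_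
    rw [commKernel_eq, one_smul, norm_smul, Real.norm_of_nonneg (by positivity)]
    unfold bump
    rw [mul_left_comm]
    gcongr
    set U := t⁻¹ • (x - y) with hU
    have hΔ := hτ.norm_smul_sub_le t x y
    rw [← hU] at hΔ
    have hΔ2 : ‖t⁻¹ • (τ x - τ y)‖ ≤ ‖U‖ / 2 :=
      hΔ.trans (by nlinarith [norm_nonneg U, hτ.le_half])
    have hΔ3 : ‖t⁻¹ • (τ x - τ y)‖ ≤ D / t := by
      rw [norm_smul, Real.norm_of_nonneg (by positivity), div_eq_inv_mul]
      gcongr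
      exact hD x y
    refine (h.norm_sub_translate_le hΔ2).trans ?_
    rw [hq]
    -- The displacement is bounded either by `α * ‖U‖`, which uses one power of decay, or by `D /
    -- t`, which uses none.
    rcases min_cases α (D / t) with ⟨e, -⟩ | ⟨e, -⟩ <;> rw [e]
    · calc _ ≤ A * 4 ^ ((n : ℝ) + 2) * (1 + ‖U‖) ^ (-((n : ℝ) + 2)) * (α * ‖U‖) := by gcongr
        _ = A * 4 ^ ((n : ℝ) + 2) * α * ((1 + ‖U‖) ^ (-((n : ℝ) + 2)) * ‖U‖) := by ring
        _ ≤ _ := by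
          gcongr
          exact decay_add_two_mul_norm_le U
    · calc _ ≤ A * 4 ^ ((n : ℝ) + 2) * (1 + ‖U‖) ^ (-((n : ℝ) + 2)) * (D / t) := by gcongr
        _ = A * 4 ^ ((n : ℝ) + 2) * (D / t) * (1 + ‖U‖) ^ (-((n : ℝ) + 2)) := by ring
        _ ≤ _ := by
          exact mul_le_mul_of_nonneg_left (decay_add_two_le U) (by positivity)
  have h₁ : ∀ x, ∫⁻ y, ‖commKernel ψ τ (fun _ => 1) t x y‖ₑ ≤
      ENNReal.ofReal q * bumpMass n ((n : ℝ) + 1) := fun x => by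
    rw [← lintegral_bump_sub_left ht x, ← lintegral_const_mul _ (by fun_prop)]
    exact lintegral_mono fun y => hb x y
  have h₂ : ∀ y, ∫⁻ x, ‖commKernel ψ τ (fun _ => 1) t x y‖ₑ ≤
      ENNReal.ofReal q * bumpMass n ((n : ℝ) + 1) := fun y => by
    rw [← lintegral_bump_sub_right ht y, ← lintegral_const_mul _ (by fun_prop)]
    exact lintegral_mono fun x => hb x y
  refine (lintegral_enorm_integral_sq_le hm h₁ h₂ hg).trans_eq ?_
  congr 1
  rw [mul_mul_mul_comm, ← sq, ← ENNReal.ofReal_pow hq0, hq, mul_pow,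
    ENNReal.ofReal_mul (by positivity)]
  ring

theorem lintegral_enorm_mul_sq_le {c : E n → ℝ} {g : E n → ℂ} {Γ : ℝ}
    (hc : ∀ y, |c y| ≤ Γ) :
    ∫⁻ y, ‖(c y : ℂ) * g y‖ₑ ^ 2 ≤ ENNReal.ofReal (Γ ^ 2) * ∫⁻ y, ‖g y‖ₑ ^ 2 := by
  rw [← lintegral_const_mul' _ _ ENNReal.ofReal_ne_top]
  refine lintegral_mono fun y => ?_
  have hΓ := (abs_nonneg _).trans (hc y)
  rw [enorm_mul, mul_pow, ENNReal.ofReal_pow hΓ]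
  gcongr
  rw [← ofReal_norm, Complex.norm_real]
  exact ENNReal.ofReal_le_ofReal (hc y)

/-- The commutator at a large scale. -/
theorem lintegral_commKernel_le (hτ : HasDeformationBounds τ j α β γ)
    (h : IsDecayingWavelet ψ A) (hD : ∀ x y, ‖τ x - τ y‖ ≤ D) {t : ℝ} (ht : 0 < t) {g : E n → ℂ}
    (hg : Measurable g) (hg2 : ∫⁻ y, ‖g y‖ₑ ^ 2 ≠ ∞) :
    ∫⁻ x, ‖∫ y, commKernel ψ τ j t x y * g y‖ₑ ^ 2 ≤
      2 * (ENNReal.ofReal ((A * 4 ^ ((n : ℝ) + 2)) ^ 2) * bumpMass n ((n : ℝ) + 1) ^ 2 *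
        ENNReal.ofReal (min α (D / t) ^ 2) *
          (ENNReal.ofReal ((1 + γ) ^ 2) * ∫⁻ y, ‖g y‖ₑ ^ 2)) +
      2 * ∫⁻ x, ‖∫ y, meanDilation ψ t (x - y) * (((1 - j y : ℝ) : ℂ) * g y)‖ₑ ^ 2 := by
  have hA := h.nonneg
  have hα := hτ.nonneg
  have hγ := hτ.jacobian_bound_nonneg
  have hjm := hτ.measurable_jacobian
  have hj1 : ∀ y, |j y| ≤ 1 + γ := fun y => by
    have h1 := abs_le.1 (hτ.abs_one_sub_le y)
    exact abs_le.2 ⟨by linarith, by linarith⟩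
  set g1 : E n → ℂ := fun y => (j y : ℂ) * g y with hg1
  set g2 : E n → ℂ := fun y => ((1 - j y : ℝ) : ℂ) * g y with hg2'
  have hg1m : Measurable g1 := by fun_prop
  have hg2m : Measurable g2 := by fun_prop
  have hg1n : ∫⁻ y, ‖g1 y‖ₑ ^ 2 ≤ ENNReal.ofReal ((1 + γ) ^ 2) * ∫⁻ y, ‖g y‖ₑ ^ 2 :=
    lintegral_enorm_mul_sq_le hj1
  have hg2n : ∫⁻ y, ‖g2 y‖ₑ ^ 2 ≤ ENNReal.ofReal (γ ^ 2) * ∫⁻ y, ‖g y‖ₑ ^ 2 :=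
    lintegral_enorm_mul_sq_le hτ.abs_one_sub_le
  have hWm : ∀ x, Measurable fun y => meanDilation ψ t (x - y) := fun x =>
    h.measurable_meanDilation (by fun_prop) (by fun_prop)
  have hKm : ∀ x, Measurable fun y => commKernel ψ τ j t x y := fun x =>
    (hτ.measurable_commKernel h).comp (by fun_prop : Measurable fun y : E n => (t, x, y))
  have i2 : ∀ x, Integrable fun y => meanDilation ψ t (x - y) * g2 y := fun x =>
    integrable_mul_of_le_bump (hWm x) hg2m
      (hg2n.trans_lt (ENNReal.mul_lt_top ENNReal.ofReal_lt_top hg2.lt_top)).ne (by positivity) ht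
      (h.isSquareKernel.norm_le t ht x)
  have i0 : ∀ x, Integrable fun y => commKernel ψ τ j t x y * g y := fun x =>
    integrable_mul_of_le_bump (hKm x) hg hg2 (by positivity) ht
      (hτ.norm_commKernel_le h ht x)
  -- Moving the Jacobian onto `g` leaves a pure translation difference, which decays in `t`, plus
  -- the wavelet transform of `(1 - j) g`, which is small in `L²` because `|1 - j| ≤ γ`.
  have hsplit : ∀ x, ∫ y, commKernel ψ τ j t x y * g y =
      (∫ y, commKernel ψ τ (fun _ => 1) t x y * g1 y) + ∫ y, meanDilation ψ t (x - y) * g2 y := by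
    intro x
    have e : ∀ y, commKernel ψ τ (fun _ => 1) t x y * g1 y =
        commKernel ψ τ j t x y * g y - meanDilation ψ t (x - y) * g2 y := fun y => by
      simp only [commKernel, hg1, hg2', Complex.real_smul, one_smul]
      push_cast
      ring
    simp_rw [e]
    rw [integral_sub (i0 x) (i2 x)]
    ring
  have hm1 : Measurable fun x => ‖∫ y, meanDilation ψ t (x - y) * g2 y‖ₑ ^ 2 := by
    have : Measurable fun z : E n × E n => meanDilation ψ t (z.1 - z.2) * g2 z.2 :=
      (h.measurable_meanDilation (by fun_prop) (by fun_prop)).mul (by fun_prop)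
    exact this.stronglyMeasurable.integral_prod_right'.measurable.enorm.pow_const 2
  calc _ ≤ ∫⁻ x, (2 * ‖∫ y, commKernel ψ τ (fun _ => 1) t x y * g1 y‖ₑ ^ 2 +
        2 * ‖∫ y, meanDilation ψ t (x - y) * g2 y‖ₑ ^ 2) := by
        refine lintegral_mono fun x => ?_
        dsimp only
        rw [hsplit]
        exact enorm_add_sq_le _ _
    _ = 2 * (∫⁻ x, ‖∫ y, commKernel ψ τ (fun _ => 1) t x y * g1 y‖ₑ ^ 2) +
        2 * ∫⁻ x, ‖∫ y, meanDilation ψ t (x - y) * g2 y‖ₑ ^ 2 := by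
        rw [lintegral_add_right _ (hm1.const_mul 2), lintegral_const_mul' _ _ (by norm_num),
          lintegral_const_mul' _ _ (by norm_num)]
    _ ≤ _ := by
        gcongr
        exact (hτ.lintegral_integral_translate_le h hD ht hg1m).trans (by gcongr)

/-- The square function of the commutator. -/
theorem lintegral_lintegral_commKernel_le (hτ : HasDeformationBounds τ j α β γ) (hβ : 0 ≤ β)
    (h : IsDecayingWavelet ψ A) (hD : ∀ x y, ‖τ x - τ y‖ ≤ D) {g : E n → ℂ}
    (hg : Measurable g) (hg2 : ∫⁻ y, ‖g y‖ₑ ^ 2 ≠ ∞) :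
    ∫⁻ t, (∫⁻ x, ‖∫ y, commKernel ψ τ j t x y * g y‖ₑ ^ 2) ∂logMeasure ≤
      (ENNReal.ofReal (16 * (A * 4 ^ ((n : ℝ) + 2) * (2 * α + 2 * γ + β)) ^ 2) *
        bumpMass n ((n : ℝ) + 1 / 2) ^ 2 +
      2 * (ENNReal.ofReal ((A * 4 ^ ((n : ℝ) + 2)) ^ 2) * bumpMass n ((n : ℝ) + 1) ^ 2 *
        ENNReal.ofReal (α ^ 2 * (Real.log (max 1 (D / α)) + 1)) * ENNReal.ofReal ((1 + γ) ^ 2)) +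
      2 * (ENNReal.ofReal (16 * (A * 4 ^ ((n : ℝ) + 2)) ^ 2) * bumpMass n ((n : ℝ) + 1 / 2) ^ 2 *
        ENNReal.ofReal (γ ^ 2))) * ∫⁻ y, ‖g y‖ₑ ^ 2 := by
  have hjm := hτ.measurable_jacobian
  have hD0 : 0 ≤ D := (norm_nonneg _).trans (hD 0 0)
  set N := ∫⁻ y, ‖g y‖ₑ ^ 2 with hN
  set g2 : E n → ℂ := fun y => ((1 - j y : ℝ) : ℂ) * g y with hg2'
  have hg2m : Measurable g2 := by fun_prop
  have hg2n : ∫⁻ y, ‖g2 y‖ₑ ^ 2 ≤ ENNReal.ofReal (γ ^ 2) * N :=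
    lintegral_enorm_mul_sq_le hτ.abs_one_sub_le
  set k₁ : ℝ → E n → E n → ℂ := fun t x y => if t ≤ 1 then commKernel ψ τ j t x y else 0
  have hk₁ := hτ.isSquareKernel_commKernel hβ h
  set K := ENNReal.ofReal ((A * 4 ^ ((n : ℝ) + 2)) ^ 2) * bumpMass n ((n : ℝ) + 1) ^ 2 with hK
  -- `G₁` carries the scales `t ≤ 1`; `G₂` and `G₃` carry `t > 1`. Keeping `G₃` at all scales costs
  -- nothing, since the wavelet square function is bounded over the full range.
  set G₁ : ℝ → ℝ≥0∞ := fun t => ∫⁻ x, ‖∫ y, k₁ t x y * g y‖ₑ ^ 2 with hG₁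
  set G₂ : ℝ → ℝ≥0∞ := (Set.Ioi 1).indicator fun t =>
    2 * (K * ENNReal.ofReal (min α (D / t) ^ 2) * (ENNReal.ofReal ((1 + γ) ^ 2) * N)) with hG₂
  set G₃ : ℝ → ℝ≥0∞ := fun t => 2 * ∫⁻ x, ‖∫ y, meanDilation ψ t (x - y) * g2 y‖ₑ ^ 2 with hG₃
  have hG₂m : Measurable G₂ := Measurable.indicator (by fun_prop) measurableSet_Ioi
  have hG₃m : Measurable G₃ := by
    have h1 : Measurable fun z : (ℝ × E n) × E n => meanDilation ψ z.1.1 (z.1.2 - z.2) * g2 z.2 :=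
      (h.measurable_meanDilation (by fun_prop) (by fun_prop)).mul (by fun_prop)
    have h2 : Measurable fun z : ℝ × E n => ‖∫ y, meanDilation ψ z.1 (z.2 - y) * g2 y‖ₑ ^ 2 :=
      h1.stronglyMeasurable.integral_prod_right'.measurable.enorm.pow_const 2
    exact h2.lintegral_prod_right'.const_mul 2
  calc _ ≤ ∫⁻ t, (G₁ t + G₂ t + G₃ t) ∂logMeasure := by
        refine lintegral_logMeasure_mono fun t ht => ?_
        rcases le_or_gt t 1 with ht1 | ht1
        · refine le_trans (le_of_eq ?_) (le_add_right le_self_add)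
          simp only [hG₁, k₁, ht1, if_true]
        · refine (hτ.lintegral_commKernel_le h hD ht hg hg2).trans ?_
          rw [← hN, ← hK]
          gcongr
          refine le_trans (le_of_eq ?_) le_add_self
          simp only [hG₂, Set.indicator_of_mem (Set.mem_Ioi.2 ht1)]
    _ = ∫⁻ t, G₁ t ∂logMeasure + ∫⁻ t, G₂ t ∂logMeasure + ∫⁻ t, G₃ t ∂logMeasure := by
        rw [lintegral_add_right _ hG₃m, lintegral_add_right _ hG₂m]
    _ ≤ ENNReal.ofReal (16 * (A * 4 ^ ((n : ℝ) + 2) * (2 * α + 2 * γ + β)) ^ 2) *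
          bumpMass n ((n : ℝ) + 1 / 2) ^ 2 * N +
        2 * (K * ENNReal.ofReal (α ^ 2 * (Real.log (max 1 (D / α)) + 1)) *
          (ENNReal.ofReal ((1 + γ) ^ 2) * N)) +
        2 * (ENNReal.ofReal (16 * (A * 4 ^ ((n : ℝ) + 2)) ^ 2) *
          bumpMass n ((n : ℝ) + 1 / 2) ^ 2 * (ENNReal.ofReal (γ ^ 2) * N)) := by
        gcongr ?_ + ?_ + ?_
        · exact hk₁.lintegral_le hg hg2
        · rw [lintegral_logMeasure]
          calc _ = ∫⁻ t in Set.Ioi 0, (Set.Ioi 1).indicator (fun t =>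
                (2 * K * (ENNReal.ofReal ((1 + γ) ^ 2) * N)) *
                  (ENNReal.ofReal t⁻¹ * ENNReal.ofReal (min α (D / t) ^ 2))) t := by
                refine lintegral_congr fun t => ?_
                by_cases ht : t ∈ Set.Ioi (1 : ℝ)
                · simp only [hG₂, Set.indicator_of_mem ht]; ring
                · simp only [hG₂, Set.indicator_of_notMem ht, mul_zero]
            _ ≤ ∫⁻ t, (Set.Ioi 1).indicator (fun t =>
                (2 * K * (ENNReal.ofReal ((1 + γ) ^ 2) * N)) *
                  (ENNReal.ofReal t⁻¹ * ENNReal.ofReal (min α (D / t) ^ 2))) t :=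
                setLIntegral_le_lintegral _ _
            _ = (2 * K * (ENNReal.ofReal ((1 + γ) ^ 2) * N)) * ∫⁻ t in Set.Ioi 1,
                  ENNReal.ofReal t⁻¹ * ENNReal.ofReal (min α (D / t) ^ 2) := by
                rw [lintegral_indicator measurableSet_Ioi, lintegral_const_mul _ (by fun_prop)]
            _ ≤ (2 * K * (ENNReal.ofReal ((1 + γ) ^ 2) * N)) *
                  ENNReal.ofReal (α ^ 2 * (Real.log (max 1 (D / α)) + 1)) := by
                gcongr
                exact lintegral_inv_mul_min_sq_le hτ.nonneg hD0
            _ = _ := by ring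
        · rw [lintegral_const_mul' _ _ (by norm_num)]
          gcongr
          refine (h.isSquareKernel.lintegral_le hg2m ?_).trans (by gcongr)
          exact (hg2n.trans_lt (ENNReal.mul_lt_top ENNReal.ofReal_lt_top hg2.lt_top)).ne
    _ = _ := by ring

end HasDeformationBounds
end
end WaveletCommutator

/-! ### The change of variables `y ↦ y - τ y` and its Jacobian -/

namespace WaveletCommutator
section
variable {n : ℕ}

/-- The determinant is a polynomial in the entries, hence Lipschitz on compact convex sets. The ball
of radius `2` for the largest entry contains `I` and every `I - Dτ` under consideration. -/
theorem exists_det_lipschitz (n : ℕ) : ∃ C : ℝ, 0 ≤ C ∧ ∀ M M' : Fin n → Fin n → ℝ,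
    ‖M‖ ≤ 2 → ‖M'‖ ≤ 2 → |(Matrix.of M).det - (Matrix.of M').det| ≤ C * ‖M - M'‖ := by
  have hd : ContDiff ℝ 1 fun M : Fin n → Fin n → ℝ => (Matrix.of M).det := by
    simp only [Matrix.det_apply, Matrix.of_apply]
    fun_prop
  obtain ⟨K, hK⟩ := hd.contDiffOn.exists_lipschitzOnWith one_ne_zero
    (convex_closedBall (0 : Fin n → Fin n → ℝ) 2) (isCompact_closedBall _ _)
  refine ⟨K, K.2, fun M M' hM hM' => ?_⟩
  have := hK.dist_le_mul M (by simpa using hM) M' (by simpa using hM')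
  rwa [Real.dist_eq, dist_eq_norm] at this

theorem sum_single (v : E n) : ∑ j, v j • EuclideanSpace.single j (1 : ℝ) = v := by
  simpa using (EuclideanSpace.basisFun (Fin n) ℝ).sum_repr v

theorem abs_apply_le_norm (v : E n) (i : Fin n) : |v i| ≤ ‖v‖ := by
  simpa using PiLp.norm_apply_le v i

theorem sum_abs_le (v : E n) : ∑ j, |v j| ≤ √n * ‖v‖ := by
  refine Real.le_sqrt_of_sq_le (y := n * ‖v‖ ^ 2) ?_ |>.trans_eq ?_
  · have := sq_sum_le_card_mul_sum_sq (s := (Finset.univ : Finset (Fin n))) (f := fun j => |v j|)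
    rw [EuclideanSpace.norm_sq_eq]
    simpa using this
  · rw [Real.sqrt_mul (by positivity), Real.sqrt_sq (norm_nonneg _)]

/-- One factor `√n` compares the `ℓ¹` and `ℓ²` norms of `v`, the other collects the `n` rows. With
entries at most `1 / (2n)` the operator norm is at most `1/2`. -/
theorem norm_clm_apply_le {L : E n →L[ℝ] E n} {a : ℝ}
    (ha : ∀ i j, |L (EuclideanSpace.single j 1) i| ≤ a) (v : E n) : ‖L v‖ ≤ n * a * ‖v‖ := by
  rcases Nat.eq_zero_or_pos n with rfl | hn
  · simp [Subsingleton.elim v 0]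
  have ha0 : 0 ≤ a := (abs_nonneg _).trans (ha ⟨0, hn⟩ ⟨0, hn⟩)
  have hi : ∀ i, |L v i| ≤ a * (√n * ‖v‖) := fun i => by
    conv_lhs => rw [← sum_single v]
    simp only [map_sum, map_smul, WithLp.ofLp_sum, Finset.sum_apply, PiLp.smul_apply, smul_eq_mul]
    calc _ ≤ ∑ j, |v j * L (EuclideanSpace.single j 1) i| := Finset.abs_sum_le_sum_abs _ _
      _ ≤ ∑ j, a * |v j| := by
        refine Finset.sum_le_sum fun j _ => ?_
        rw [abs_mul, mul_comm]
        gcongr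
        exact ha i j
      _ = a * ∑ j, |v j| := by rw [Finset.mul_sum]
      _ ≤ _ := by gcongr; exact sum_abs_le v
  rw [EuclideanSpace.norm_eq]
  refine Real.sqrt_le_iff.2 ⟨by positivity, ?_⟩
  calc ∑ i, ‖L v i‖ ^ 2 ≤ ∑ i : Fin n, (a * (√n * ‖v‖)) ^ 2 := by
        refine Finset.sum_le_sum fun i _ => ?_
        rw [Real.norm_eq_abs]
        gcongr
        exact hi i
    _ = n * (√n ^ 2) * (a * ‖v‖) ^ 2 := by
        simp only [Finset.sum_const, Finset.card_univ, Fintype.card_fin, nsmul_eq_mul]; ring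
    _ = _ := by rw [Real.sq_sqrt (by positivity)]; ring

/-- A `C²` deformation with entrywise bounds on its derivatives. -/
structure IsBoundedDeformation (τ : E n → E n) (a b : ℝ) : Prop where
  contDiff : ContDiff ℝ 2 τ
  nonneg : 0 ≤ a
  nonneg' : 0 ≤ b
  mul_le_half : n * a ≤ 1 / 2
  abs_fderiv_le : ∀ x i j, |fderiv ℝ τ x (EuclideanSpace.single j 1) i| ≤ a
  abs_fderiv_fderiv_le : ∀ x i j k, |fderiv ℝ (fderiv ℝ τ) x (EuclideanSpace.single k 1)
    (EuclideanSpace.single j 1) i| ≤ b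

namespace IsBoundedDeformation
variable {τ : E n → E n} {a b : ℝ}

theorem differentiable (h : IsBoundedDeformation τ a b) : Differentiable ℝ τ :=
  h.contDiff.differentiable (by norm_num)

theorem differentiable_fderiv (h : IsBoundedDeformation τ a b) : Differentiable ℝ (fderiv ℝ τ) :=
  (h.contDiff.fderiv_right (m := 1) (by norm_num)).differentiable (by norm_num)

theorem norm_sub_le (h : IsBoundedDeformation τ a b) (x y : E n) :
    ‖τ x - τ y‖ ≤ n * a * ‖x - y‖ := by
  have ha := h.nonneg
  refine Convex.norm_image_sub_le_of_norm_fderiv_le (𝕜 := ℝ) (s := Set.univ)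
    (fun x _ => h.differentiable x) (fun x _ => ?_) convex_univ (Set.mem_univ _) (Set.mem_univ _)
  exact ContinuousLinearMap.opNorm_le_bound _ (by positivity)
    (norm_clm_apply_le (h.abs_fderiv_le x))

theorem abs_fderiv_sub_le (h : IsBoundedDeformation τ a b) (x y : E n) (i j : Fin n) :
    |fderiv ℝ τ x (EuclideanSpace.single j 1) i - fderiv ℝ τ y (EuclideanSpace.single j 1) i| ≤
      n * b * ‖x - y‖ := by
  have hb := h.nonneg'
  set Λ : (E n →L[ℝ] E n) →L[ℝ] ℝ := (EuclideanSpace.proj i : E n →L[ℝ] ℝ).comp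
    (ContinuousLinearMap.apply ℝ (E n) (EuclideanSpace.single j 1)) with hΛ
  have hd : ∀ x, HasFDerivAt (fun x => Λ (fderiv ℝ τ x)) (Λ.comp (fderiv ℝ (fderiv ℝ τ) x)) x :=
    fun x => Λ.hasFDerivAt.comp x (h.differentiable_fderiv x).hasFDerivAt
  refine Convex.norm_image_sub_le_of_norm_hasFDerivWithin_le (𝕜 := ℝ) (s := Set.univ)
    (fun x _ => (hd x).hasFDerivWithinAt) (fun x _ => ?_) convex_univ (Set.mem_univ _)
    (Set.mem_univ _)
  refine ContinuousLinearMap.opNorm_le_bound _ (by positivity) fun v => ?_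
  conv_lhs => rw [← sum_single v]
  simp only [map_sum, map_smul, smul_eq_mul]
  calc _ ≤ ∑ k, ‖v k * _‖ := norm_sum_le _ _
    _ ≤ ∑ k : Fin n, ‖v‖ * b := by
        refine Finset.sum_le_sum fun k _ => ?_
        rw [norm_mul]
        exact mul_le_mul (abs_apply_le_norm v k) (h.abs_fderiv_fderiv_le x i j k) (norm_nonneg _)
          (norm_nonneg _)
    _ = _ := by simp; ring

theorem antilipschitz (h : IsBoundedDeformation τ a b) :
    AntilipschitzWith 2 fun y => y - τ y := by
  refine AntilipschitzWith.of_le_mul_dist fun x y => ?_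
  rw [dist_eq_norm, dist_eq_norm, show x - τ x - (y - τ y) = (x - y) - (τ x - τ y) by abel]
  have h1 := h.norm_sub_le x y
  have h2 := norm_sub_norm_le (x - y) (τ x - τ y)
  have h3 := mul_le_mul_of_nonneg_right h.mul_le_half (norm_nonneg (x - y))
  push_cast
  linarith

/-- Solving `y - τ y = z` means finding a fixed point of `y ↦ z + τ y`, which is a contraction with
constant `1/2`. -/
theorem surjective (h : IsBoundedDeformation τ a b) : Function.Surjective fun y => y - τ y := by
  intro z
  have hc : ContractingWith (1 / 2) fun y => z + τ y := by
    refine ⟨by rw [← NNReal.coe_lt_coe]; norm_num, LipschitzWith.of_dist_le_mul fun x y => ?_⟩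
    rw [dist_add_left, dist_eq_norm, dist_eq_norm]
    refine (h.norm_sub_le x y).trans ?_
    push_cast
    exact mul_le_mul_of_nonneg_right h.mul_le_half (norm_nonneg (x - y))
  refine ⟨hc.fixedPoint, ?_⟩
  have : z + τ hc.fixedPoint = hc.fixedPoint := hc.fixedPoint_isFixedPt
  exact sub_eq_iff_eq_add.2 this.symm

/-- The derivative of `y ↦ y - τ y`. -/
theorem hasFDerivAt (h : IsBoundedDeformation τ a b) (y : E n) :
    HasFDerivAt (fun y => y - τ y) (ContinuousLinearMap.id ℝ (E n) - fderiv ℝ τ y) y :=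
  (hasFDerivAt_id y).sub (h.differentiable y).hasFDerivAt

theorem integral_jacobian_smul (h : IsBoundedDeformation τ a b) (g : E n → ℂ) :
    ∫ y, |(ContinuousLinearMap.id ℝ (E n) - fderiv ℝ τ y).det| • g (y - τ y) = ∫ z, g z := by
  have := integral_image_eq_integral_abs_det_fderiv_smul (volume : Measure (E n))
    MeasurableSet.univ (fun y _ => (h.hasFDerivAt y).hasFDerivWithinAt)
    h.antilipschitz.injective.injOn g
  rw [Set.image_univ, h.surjective.range_eq] at this
  simpa using this.symm

/-- The inverse of `y ↦ y - τ y` is 2-Lipschitz, so preimages have at most `2^n` times the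
`n`-dimensional Hausdorff measure, of which Lebesgue measure is a multiple. No lower bound on the
Jacobian is needed. -/
theorem map_le (h : IsBoundedDeformation τ a b) :
    Measure.map (fun y => y - τ y) (volume : Measure (E n)) ≤ (2 : ℝ≥0∞) ^ n • volume := by
  have hc : Continuous fun y => y - τ y := continuous_id.sub h.contDiff.continuous
  have hv := Measure.isAddLeftInvariant_eq_smul (volume : Measure (E n)) (Measure.hausdorffMeasure n)
  refine Measure.le_iff.2 fun s hs => ?_
  rw [Measure.map_apply hc.measurable hs, Measure.smul_apply, smul_eq_mul, hv, Measure.smul_apply,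
    Measure.smul_apply, mul_smul_comm]
  gcongr
  have := h.antilipschitz.hausdorffMeasure_preimage_le (d := n) (by positivity) s
  simpa using this

theorem lintegral_comp_le (h : IsBoundedDeformation τ a b) {g : E n → ℝ≥0∞} (hg : Measurable g) :
    ∫⁻ y, g (y - τ y) ≤ 2 ^ n * ∫⁻ z, g z := by
  have hc : Continuous fun y => y - τ y := continuous_id.sub h.contDiff.continuous
  rw [← lintegral_map hg hc.measurable]
  refine (lintegral_mono' h.map_le le_rfl).trans_eq ?_
  rw [lintegral_smul_measure, smul_eq_mul]

theorem quasiMeasurePreserving (h : IsBoundedDeformation τ a b) :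
    Measure.QuasiMeasurePreserving (fun y => y - τ y) (volume : Measure (E n)) volume := by
  have hc : Continuous fun y => y - τ y := continuous_id.sub h.contDiff.continuous
  exact ⟨hc.measurable, (Measure.absolutelyContinuous_of_le h.map_le).trans
    Measure.smul_absolutelyContinuous⟩

theorem det_eq (L : E n →L[ℝ] E n) :
    L.det = (Matrix.of fun i j => L (EuclideanSpace.single j 1) i).det := by
  rw [ContinuousLinearMap.det, ← LinearMap.det_toMatrix (EuclideanSpace.basisFun (Fin n) ℝ).toBasis]
  congr 1

/-- Entrywise, `I - Dτ` stays within `a` of `I` and is Lipschitz with constant `n * b`. The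
Lipschitz bound for the determinant transfers both facts to the Jacobian, with a constant depending
on `n` alone. -/
theorem exists_hasDeformationBounds (n : ℕ) : ∃ C : ℝ, 0 ≤ C ∧
    ∀ (τ : E n → E n) (a b : ℝ), IsBoundedDeformation τ a b →
      HasDeformationBounds τ
        (fun y => |(ContinuousLinearMap.id ℝ (E n) - fderiv ℝ τ y).det|) (n * a) (C * (n * b))
        (C * a) := by
  obtain ⟨C, hC, hdet⟩ := exists_det_lipschitz n
  refine ⟨C, hC, fun τ a b h => ?_⟩
  have ha := h.nonneg
  have hb := h.nonneg'
  set M : E n → Fin n → Fin n → ℝ := fun y i j =>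
    (ContinuousLinearMap.id ℝ (E n) - fderiv ℝ τ y) (EuclideanSpace.single j 1) i with hM
  set I : Fin n → Fin n → ℝ := fun i j =>
    (ContinuousLinearMap.id ℝ (E n)) (EuclideanSpace.single j 1) i with hI
  have hI1 : (Matrix.of I).det = 1 := by
    rw [hI, ← det_eq, ContinuousLinearMap.det]
    simp
  have hIn : ‖I‖ ≤ 1 := by
    refine (pi_norm_le_iff_of_nonneg zero_le_one).2 fun i =>
      (pi_norm_le_iff_of_nonneg zero_le_one).2 fun j => ?_
    simp only [hI, ContinuousLinearMap.id_apply, PiLp.single_apply]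
    split_ifs <;> simp
  have hIM : ∀ y, ‖I - M y‖ ≤ a := fun y => by
    refine (pi_norm_le_iff_of_nonneg ha).2 fun i => (pi_norm_le_iff_of_nonneg ha).2 fun j => ?_
    simpa [hI, hM] using h.abs_fderiv_le y i j
  have hMM : ∀ y y', ‖M y - M y'‖ ≤ n * b * ‖y - y'‖ := fun y y' => by
    refine (pi_norm_le_iff_of_nonneg (by positivity)).2 fun i =>
      (pi_norm_le_iff_of_nonneg (by positivity)).2 fun j => ?_
    have := h.abs_fderiv_sub_le y y' i j
    rw [abs_sub_comm] at this
    simpa [hM] using this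
  have hM2 : ∀ y, ‖M y‖ ≤ 2 := fun y => by
    -- For `n = 0` the hypothesis `n * a ≤ 1/2` does not bound `a`, but there are no entries;
    -- otherwise `1 + a ≤ 2`.
    rcases Nat.eq_zero_or_pos n with rfl | hn
    · rw [Subsingleton.elim (M y) 0, norm_zero]; norm_num
    have h1 : (1 : ℝ) ≤ n := by exact_mod_cast hn
    have h2 := norm_sub_norm_le (M y) I
    rw [norm_sub_rev] at h2
    nlinarith [hIM y, h.mul_le_half]
  refine ⟨h.contDiff.continuous.measurable, ?_, by positivity, h.mul_le_half, h.norm_sub_le,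
    fun y => ?_, fun y y' => ?_, h.integral_jacobian_smul⟩
  · have : Continuous fun y => (ContinuousLinearMap.id ℝ (E n) - fderiv ℝ τ y).det :=
      ContinuousLinearMap.continuous_det.comp
        (continuous_const.sub h.differentiable_fderiv.continuous)
    exact this.abs.measurable
  · rw [det_eq]
    have e : |1 - abs (Matrix.of (M y)).det| =
        |abs (Matrix.of I).det - abs (Matrix.of (M y)).det| := by
      rw [hI1, abs_one]
    calc _ = _ := e
      _ ≤ |(Matrix.of I).det - (Matrix.of (M y)).det| := abs_abs_sub_abs_le _ _
      _ ≤ C * ‖I - M y‖ := hdet _ _ (by linarith) (hM2 y)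
      _ ≤ C * a := by gcongr; exact hIM y
  · rw [det_eq, det_eq]
    calc _ ≤ |(Matrix.of (M y)).det - (Matrix.of (M y')).det| := abs_abs_sub_abs_le _ _
      _ ≤ C * ‖M y - M y'‖ := hdet _ _ (hM2 y) (hM2 y')
      _ ≤ C * (n * b * ‖y - y'‖) := by gcongr; exact hMM y y'
      _ = _ := by ring

end IsBoundedDeformation
end
end WaveletCommutator

/-! ### The commutator in the scale normalization -/

namespace WaveletCommutator
section
variable {n : ℕ}

theorem eLpNorm_two_eq {X : Type*} [MeasurableSpace X] (μ : Measure X) (f : X → ℂ) :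
    eLpNorm f 2 μ = (∫⁻ x, ‖f x‖ₑ ^ 2 ∂μ) ^ (1 / 2 : ℝ) := by
  rw [eLpNorm_eq_lintegral_rpow_enorm_toReal (by norm_num) (by norm_num)]
  simp

theorem eLpNorm_two_le {X Y : Type*} [MeasurableSpace X] [MeasurableSpace Y] {μ : Measure X}
    {ν : Measure Y} {f : X → ℂ} {F : Y → ℂ} {K : ℝ≥0∞}
    (h : ∫⁻ y, ‖F y‖ₑ ^ 2 ∂ν ≤ K ^ 2 * ∫⁻ x, ‖f x‖ₑ ^ 2 ∂μ) :
    eLpNorm F 2 ν ≤ K * eLpNorm f 2 μ := by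
  rw [eLpNorm_two_eq, eLpNorm_two_eq]
  refine (ENNReal.rpow_le_rpow h (by norm_num)).trans_eq ?_
  rw [ENNReal.mul_rpow_of_nonneg _ _ (by norm_num), ← ENNReal.rpow_two, ← ENNReal.rpow_mul]
  norm_num

theorem lintegral_enorm_sq_ne_top {X : Type*} [MeasurableSpace X] {μ : Measure X} {f : X → ℂ}
    (hf : MemLp f 2 μ) : ∫⁻ x, ‖f x‖ₑ ^ 2 ∂μ ≠ ∞ := by
  intro h
  have := hf.2
  rw [eLpNorm_two_eq, h] at this
  simp at this

instance : SFinite (scaleMeasure n) := by unfold scaleMeasure; infer_instance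

theorem lintegral_scaleMeasure (g : ℝ → ℝ≥0∞) :
    ∫⁻ t, g t ∂(scaleMeasure n) =
      ∫⁻ t in Set.Ioi 0, ENNReal.ofReal (t ^ (-((n : ℝ) + 1))) * g t := by
  unfold scaleMeasure
  rw [lintegral_withDensity_eq_lintegral_mul_non_measurable _ (by fun_prop)
    (Filter.Eventually.of_forall fun t => ENNReal.ofReal_lt_top)]
  rfl

theorem scaleDilation_eq (ψ : E n → ℂ) {t : ℝ} (ht : 0 < t) (u : E n) :
    scaleDilation ψ t u = ((t ^ ((n : ℝ) / 2) : ℝ) : ℂ) * meanDilation ψ t u := by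
  unfold scaleDilation meanDilation
  rw [Complex.real_smul, Complex.real_smul, ← mul_assoc, ← Complex.ofReal_mul]
  congr 2
  rw [← Real.rpow_natCast, ← Real.rpow_neg ht.le, ← Real.rpow_add ht]
  congr 1
  ring

theorem waveletTransform_apply (Ψ : ℝ → E n → ℂ) (f : E n → ℂ) (x : E n) (t : ℝ) :
    waveletTransform Ψ f (x, t) = ∫ y, f y * Ψ t (x - y) := by
  simp [waveletTransform, convolution]

/-- `L_τ` respects almost everywhere equality because preimages of null sets under `y ↦ y - τ y` are
null. An `L²` function may thus be replaced by a measurable representative. -/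
theorem commutator_congr_ae {τ : E n → E n} {a b : ℝ} (hτ : IsBoundedDeformation τ a b)
    (Ψ : ℝ → E n → ℂ) {f f' : E n → ℂ} (h : f =ᵐ[volume] f') :
    commutator Ψ τ f = commutator Ψ τ f' := by
  have h2 : deform τ f =ᵐ[volume] deform τ f' := hτ.quasiMeasurePreserving.ae_eq_comp h
  have e : ∀ {g g' : E n → ℂ}, g =ᵐ[volume] g' → waveletTransform Ψ g = waveletTransform Ψ g' := by
    intro g g' hg
    ext ⟨x, t⟩
    rw [waveletTransform_apply, waveletTransform_apply]
    refine integral_congr_ae ?_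
    filter_upwards [hg] with y hy
    rw [hy]
  unfold commutator
  rw [e h, e h2]

namespace IsDecayingWavelet
variable {ψ : E n → ℂ} {A : ℝ}

theorem measurable_scaleDilation (h : IsDecayingWavelet ψ A) :
    Measurable fun z : ℝ × E n => scaleDilation ψ z.1 z.2 := by
  unfold scaleDilation
  exact (by fun_prop : Measurable fun z : ℝ × E n => z.1 ^ (-((n : ℝ) / 2))).smul
    (h.measurable.comp (by fun_prop : Measurable fun z : ℝ × E n => z.1⁻¹ • z.2))

theorem measurable_waveletTransform (h : IsDecayingWavelet ψ A) {f : E n → ℂ}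
    (hf : Measurable f) : Measurable (waveletTransform (scaleDilation ψ) f) := by
  have h1 : Measurable fun z : (E n × ℝ) × E n => f z.2 * scaleDilation ψ z.1.2 (z.1.1 - z.2) :=
    Measurable.mul (by fun_prop) (h.measurable_scaleDilation.comp
      (by fun_prop : Measurable fun z : (E n × ℝ) × E n => (z.1.2, z.1.1 - z.2)))
  have h2 : Measurable fun z : E n × ℝ => ∫ y, f y * scaleDilation ψ z.2 (z.1 - y) :=
    h1.stronglyMeasurable.integral_prod_right'.measurable
  convert h2 using 1
  ext ⟨x, t⟩
  rw [waveletTransform_apply]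

theorem measurable_commutator (h : IsDecayingWavelet ψ A) {τ : E n → E n} (hτ : Measurable τ)
    {f : E n → ℂ} (hf : Measurable f) : Measurable (commutator (scaleDilation ψ) τ f) := by
  have hd : Measurable (deform τ f) :=
    hf.comp (by fun_prop : Measurable fun x : E n => x - τ x)
  exact (h.measurable_waveletTransform hd).sub ((h.measurable_waveletTransform hf).comp
    (by fun_prop : Measurable fun p : E n × ℝ => (p.1 - τ p.1, p.2)))

end IsDecayingWavelet

/-- The substitution `z = y - τ y` expresses the undeformed transform at `x - τ x` through `deform τ
f`, so that both halves act on the same function. -/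
theorem commutator_eq {ψ : E n → ℂ} {A : ℝ} (h : IsDecayingWavelet ψ A) {τ : E n → E n}
    {j : E n → ℝ} {α β γ : ℝ} (hτ : HasDeformationBounds τ j α β γ) {f : E n → ℂ}
    (hf : Measurable f) (hf2 : ∫⁻ y, ‖deform τ f y‖ₑ ^ 2 ≠ ∞) {t : ℝ} (ht : 0 < t) (x : E n) :
    commutator (scaleDilation ψ) τ f (x, t) =
      ((t ^ ((n : ℝ) / 2) : ℝ) : ℂ) * ∫ y, commKernel ψ τ j t x y * deform τ f y := by
  have hA := h.nonneg
  have hα := hτ.nonneg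
  have hγ := hτ.jacobian_bound_nonneg
  have hτm := hτ.measurable
  have hd : Measurable (deform τ f) :=
    hf.comp (by fun_prop : Measurable fun x : E n => x - τ x)
  have hWm : Measurable fun y => meanDilation ψ t (x - y) :=
    h.measurable_meanDilation (by fun_prop) (by fun_prop)
  have hKm : Measurable fun y => commKernel ψ τ j t x y :=
    (hτ.measurable_commKernel h).comp (by fun_prop : Measurable fun y : E n => (t, x, y))
  have i1 : Integrable fun y => meanDilation ψ t (x - y) * deform τ f y :=
    integrable_mul_of_le_bump hWm hd hf2 (by positivity) ht (h.isSquareKernel.norm_le t ht x)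
  have i2 : Integrable fun y => commKernel ψ τ j t x y * deform τ f y :=
    integrable_mul_of_le_bump hKm hd hf2 (by positivity) ht (hτ.norm_commKernel_le h ht x)
  have e1 : ∫ z, f z * meanDilation ψ t (x - τ x - z) =
      ∫ y, (meanDilation ψ t (x - y) * deform τ f y - commKernel ψ τ j t x y * deform τ f y) := by
    rw [← hτ.change_of_variables]
    congr 1
    ext y
    simp only [deform, commKernel, Complex.real_smul]
    ring
  have e2 : ∀ z, ∫ y, f y * scaleDilation ψ t (z - y) =
      ((t ^ ((n : ℝ) / 2) : ℝ) : ℂ) * ∫ y, f y * meanDilation ψ t (z - y) := fun z => by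
    rw [← integral_const_mul]
    simp_rw [scaleDilation_eq ψ ht, mul_left_comm]
  have e3 : ∫ y, deform τ f y * scaleDilation ψ t (x - y) =
      ((t ^ ((n : ℝ) / 2) : ℝ) : ℂ) * ∫ y, meanDilation ψ t (x - y) * deform τ f y := by
    rw [← integral_const_mul]
    congr 1
    ext y
    rw [scaleDilation_eq ψ ht]
    ring
  have e4 : commutator (scaleDilation ψ) τ f (x, t) =
      (∫ y, deform τ f y * scaleDilation ψ t (x - y)) -
        ∫ y, f y * scaleDilation ψ t (x - τ x - y) := by
    rw [← waveletTransform_apply, ← waveletTransform_apply]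
    rfl
  rw [e4, e3, e2, e1, integral_sub i1 i2]
  ring

/-- The commutator estimate with explicit dependence on the bounds of the deformation. -/
theorem lintegral_commutator_le {ψ : E n → ℂ} {A : ℝ} (h : IsDecayingWavelet ψ A) {τ : E n → E n}
    {j : E n → ℝ} {α β γ a b D : ℝ} (hτ : HasDeformationBounds τ j α β γ)
    (hτ' : IsBoundedDeformation τ a b) (hβ : 0 ≤ β) (hD : ∀ x y, ‖τ x - τ y‖ ≤ D) {f : E n → ℂ}
    (hf : Measurable f) (hf2 : ∫⁻ y, ‖f y‖ₑ ^ 2 ≠ ∞) :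
    ∫⁻ p, ‖commutator (scaleDilation ψ) τ f p‖ₑ ^ 2 ∂((volume : Measure (E n)).prod (scaleMeasure n))
      ≤ (ENNReal.ofReal (16 * (A * 4 ^ ((n : ℝ) + 2) * (2 * α + 2 * γ + β)) ^ 2) *
        bumpMass n ((n : ℝ) + 1 / 2) ^ 2 +
      2 * (ENNReal.ofReal ((A * 4 ^ ((n : ℝ) + 2)) ^ 2) * bumpMass n ((n : ℝ) + 1) ^ 2 *
        ENNReal.ofReal (α ^ 2 * (Real.log (max 1 (D / α)) + 1)) * ENNReal.ofReal ((1 + γ) ^ 2)) +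
      2 * (ENNReal.ofReal (16 * (A * 4 ^ ((n : ℝ) + 2)) ^ 2) * bumpMass n ((n : ℝ) + 1 / 2) ^ 2 *
        ENNReal.ofReal (γ ^ 2))) * (2 ^ n * ∫⁻ y, ‖f y‖ₑ ^ 2) := by
  have hτm := hτ.measurable
  have hd : Measurable (deform τ f) :=
    hf.comp (by fun_prop : Measurable fun x : E n => x - τ x)
  have hdn : ∫⁻ y, ‖deform τ f y‖ₑ ^ 2 ≤ 2 ^ n * ∫⁻ y, ‖f y‖ₑ ^ 2 :=
    hτ'.lintegral_comp_le (g := fun y => ‖f y‖ₑ ^ 2) (by fun_prop)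
  have hd2 : ∫⁻ y, ‖deform τ f y‖ₑ ^ 2 ≠ ∞ :=
    (hdn.trans_lt (ENNReal.mul_lt_top (by simp) hf2.lt_top)).ne
  have hm := ((h.measurable_commutator hτm hf).enorm.pow_const 2)
  rw [lintegral_prod_symm _ hm.aemeasurable, lintegral_scaleMeasure]
  refine le_trans ?_ (mul_le_mul_right hdn _)
  refine le_trans (le_of_eq ?_) (hτ.lintegral_lintegral_commKernel_le hβ h hD hd hd2)
  rw [lintegral_logMeasure]
  -- The weights combine as `t^(-(n+1)) (t^(n/2))² = t⁻¹`, so the measure becomes `dt / t`.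
  refine setLIntegral_congr_fun measurableSet_Ioi fun t (ht : 0 < t) => ?_
  simp_rw [commutator_eq h hτ hf hd2 ht, enorm_mul, mul_pow]
  rw [lintegral_const_mul' _ _ (by simp), ← mul_assoc]
  congr 1
  rw [← ofReal_norm, Complex.norm_real, Real.norm_of_nonneg (by positivity),
    ← ENNReal.ofReal_pow (by positivity), ← ENNReal.ofReal_mul (by positivity)]
  congr 1
  rw [← Real.rpow_natCast, ← Real.rpow_mul ht.le, ← Real.rpow_add ht, ← Real.rpow_neg_one]
  congr 1
  push_cast
  ring

/-- Each of `a`, `b` and `a * L` is at most `X = a * L + b`, and every term is quadratic in such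
quantities up to the harmless factor `1 + C * a ≤ 1 + C`. The logarithm `ℓ` enters linearly in the
squared norm, and `ℓ + 1 ≤ 2 * L ^ 2` is a generous bound for it. -/
theorem sum_constants_le {A q c₁ c₂ C N a b L ℓ : ℝ} (hA : 0 ≤ A) (hq : 0 ≤ q) (hC : 0 ≤ C)
    (hN : 0 ≤ N) (ha : 0 ≤ a) (ha1 : a ≤ 1) (hb : 0 ≤ b) (hL : 1 ≤ L) (hℓ : ℓ ≤ L) :
    16 * (A * q * (2 * (N * a) + 2 * (C * a) + C * (N * b))) ^ 2 * c₁ ^ 2 +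
      2 * ((A * q) ^ 2 * c₂ ^ 2 * ((N * a) ^ 2 * (ℓ + 1)) * (1 + C * a) ^ 2) +
      2 * (16 * (A * q) ^ 2 * c₁ ^ 2 * (C * a) ^ 2) ≤
    (16 * (q * (2 * N + 2 * C + C * N)) ^ 2 * c₁ ^ 2 +
      2 * (q ^ 2 * c₂ ^ 2 * (N ^ 2 * 2) * (1 + C) ^ 2) +
      2 * (16 * q ^ 2 * c₁ ^ 2 * C ^ 2)) * (A * (a * L + b)) ^ 2 := by
  set X := a * L + b with hX
  have haX : a ≤ X := by nlinarith
  have hX0 : 0 ≤ X := ha.trans haX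
  have hbX : b ≤ X := by nlinarith
  have haL : a * L ≤ X := by linarith
  have t1 : 2 * (N * a) + 2 * (C * a) + C * (N * b) ≤ (2 * N + 2 * C + C * N) * X := by
    calc _ ≤ 2 * (N * X) + 2 * (C * X) + C * (N * X) := by gcongr
      _ = _ := by ring
  have t2 : (N * a) ^ 2 * (ℓ + 1) ≤ N ^ 2 * 2 * X ^ 2 := by
    have h1 : a ^ 2 * (ℓ + 1) ≤ 2 * X ^ 2 := by
      calc a ^ 2 * (ℓ + 1) ≤ a ^ 2 * (2 * L ^ 2) := by
            gcongr
            nlinarith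
        _ = 2 * (a * L) ^ 2 := by ring
        _ ≤ _ := by gcongr
    calc _ = N ^ 2 * (a ^ 2 * (ℓ + 1)) := by ring
      _ ≤ N ^ 2 * (2 * X ^ 2) := by gcongr
      _ = _ := by ring
  have t3 : C * a ≤ C := mul_le_of_le_one_right hC ha1
  have t4 : C * a ≤ C * X := by gcongr
  have p2 : (A * q) ^ 2 * c₂ ^ 2 * ((N * a) ^ 2 * (ℓ + 1)) * (1 + C * a) ^ 2 ≤
      (A * q) ^ 2 * c₂ ^ 2 * (N ^ 2 * 2 * X ^ 2) * (1 + C) ^ 2 := by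
    refine mul_le_mul (mul_le_mul_of_nonneg_left t2 (by positivity)) (by gcongr) (by positivity)
      (by positivity)
  calc _ ≤ 16 * (A * q * ((2 * N + 2 * C + C * N) * X)) ^ 2 * c₁ ^ 2 +
      2 * ((A * q) ^ 2 * c₂ ^ 2 * (N ^ 2 * 2 * X ^ 2) * (1 + C) ^ 2) +
      2 * (16 * (A * q) ^ 2 * c₁ ^ 2 * (C * X) ^ 2) := by gcongr
    _ = _ := by ring

theorem ofReal_sum_constants {c₁ c₂ x y z w v u : ℝ} (hc₁ : 0 ≤ c₁) (hc₂ : 0 ≤ c₂) (hx : 0 ≤ x)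
    (hy : 0 ≤ y) (hz : 0 ≤ z) (hw : 0 ≤ w) (hv : 0 ≤ v) (hu : 0 ≤ u) :
    ENNReal.ofReal x * ENNReal.ofReal c₁ ^ 2 +
      2 * (ENNReal.ofReal y * ENNReal.ofReal c₂ ^ 2 * ENNReal.ofReal z * ENNReal.ofReal w) +
      2 * (ENNReal.ofReal v * ENNReal.ofReal c₁ ^ 2 * ENNReal.ofReal u) =
    ENNReal.ofReal (x * c₁ ^ 2 + 2 * (y * c₂ ^ 2 * z * w) + 2 * (v * c₁ ^ 2 * u)) := by
  lift c₁ to NNReal using hc₁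
  lift c₂ to NNReal using hc₂
  lift x to NNReal using hx
  lift y to NNReal using hy
  lift z to NNReal using hz
  lift w to NNReal using hw
  lift v to NNReal using hv
  lift u to NNReal using hu
  norm_cast
  simp only [ENNReal.ofReal_coe_nnreal]
  norm_cast

theorem exists_eLpNorm_commutator_le (n : ℕ) (hn : 1 ≤ n) : ∃ C : ℝ, 0 < C ∧
    ∀ (ψ : E n → ℂ) (A : ℝ), IsDecayingWavelet ψ A → ∀ (τ : E n → E n) (a b D L : ℝ),
      IsBoundedDeformation τ a b → (∀ x y, ‖τ x - τ y‖ ≤ D) → 1 ≤ L →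
      Real.log (max 1 (D / (n * a))) ≤ L → ∀ f : E n → ℂ, MemLp f 2 volume →
        AEStronglyMeasurable (commutator (scaleDilation ψ) τ f)
          ((volume : Measure (E n)).prod (scaleMeasure n)) ∧
        eLpNorm (commutator (scaleDilation ψ) τ f) 2
            ((volume : Measure (E n)).prod (scaleMeasure n)) ≤
          ENNReal.ofReal (C * A * (a * L + b)) * eLpNorm f 2 volume := by
  obtain ⟨C, hC, hCb⟩ := IsBoundedDeformation.exists_hasDeformationBounds n
  set c₁ := (bumpMass n ((n : ℝ) + 1 / 2)).toReal with hc₁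
  set c₂ := (bumpMass n ((n : ℝ) + 1)).toReal with hc₂
  have hc₁' : bumpMass n ((n : ℝ) + 1 / 2) = ENNReal.ofReal c₁ :=
    (ENNReal.ofReal_toReal (bumpMass_lt_top (by linarith)).ne).symm
  have hc₂' : bumpMass n ((n : ℝ) + 1) = ENNReal.ofReal c₂ :=
    (ENNReal.ofReal_toReal (bumpMass_lt_top (by linarith)).ne).symm
  have hc₁0 : 0 ≤ c₁ := ENNReal.toReal_nonneg
  have hc₂0 : 0 ≤ c₂ := ENNReal.toReal_nonneg
  set q : ℝ := 4 ^ ((n : ℝ) + 2) with hq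
  have hq0 : 0 < q := by positivity
  set K : ℝ := 16 * (q * (2 * n + 2 * C + C * n)) ^ 2 * c₁ ^ 2 +
    2 * (q ^ 2 * c₂ ^ 2 * (n ^ 2 * 2) * (1 + C) ^ 2) +
    2 * (16 * q ^ 2 * c₁ ^ 2 * C ^ 2) with hK
  have hK0 : 0 ≤ K := by positivity
  -- The factor `2 ^ n` is the squared norm bound of `L_τ`; the summand `1` only secures positivity.
  refine ⟨√(K * 2 ^ n) + 1, by positivity, fun ψ A h τ a b D L hτ hD hL hDL f hf => ?_⟩
  have hA := h.nonneg
  have ha := hτ.nonneg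
  have hb := hτ.nonneg'
  have hτc := hCb τ a b hτ
  have hn1 : (1 : ℝ) ≤ n := by exact_mod_cast hn
  have hae := hf.1.ae_eq_mk
  set f' := hf.1.mk f with hf'
  have hfm : Measurable f' := hf.1.stronglyMeasurable_mk.measurable
  have hf2 : ∫⁻ y, ‖f' y‖ₑ ^ 2 ≠ ∞ := lintegral_enorm_sq_ne_top ((memLp_congr_ae hae).1 hf)
  rw [commutator_congr_ae hτ _ hae, eLpNorm_congr_ae hae]
  refine ⟨(h.measurable_commutator hτc.measurable hfm).aestronglyMeasurable, eLpNorm_two_le ?_⟩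
  refine (lintegral_commutator_le h hτc hτ (by positivity) hD hfm hf2).trans ?_
  rw [← mul_assoc]
  gcongr
  have ha1 : a ≤ 1 := by nlinarith [hτ.mul_le_half]
  have hℓ0 : 0 ≤ Real.log (max 1 (D / (n * a))) := Real.log_nonneg (le_max_left _ _)
  have hX0 : 0 ≤ a * L + b := by positivity
  rw [hc₁', hc₂', ofReal_sum_constants hc₁0 hc₂0 (by positivity) (by positivity) (by positivity)
    (by positivity) (by positivity) (by positivity), show (2 : ℝ≥0∞) = ENNReal.ofReal 2 by simp,
    ← ENNReal.ofReal_pow zero_le_two, ← ENNReal.ofReal_mul (by positivity),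
    ← ENNReal.ofReal_pow (by positivity)]
  refine ENNReal.ofReal_le_ofReal ?_
  refine (mul_le_mul_of_nonneg_right (sum_constants_le hA hq0.le hC (Nat.cast_nonneg n) ha ha1 hb hL
    hDL) (by positivity)).trans ?_
  rw [← hK]
  calc K * (A * (a * L + b)) ^ 2 * 2 ^ n = (K * 2 ^ n) * (A * (a * L + b)) ^ 2 := by ring
    _ = √(K * 2 ^ n) ^ 2 * (A * (a * L + b)) ^ 2 := by rw [Real.sq_sqrt (by positivity)]
    _ ≤ (√(K * 2 ^ n) + 1) ^ 2 * (A * (a * L + b)) ^ 2 := by gcongr; linarith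
    _ = _ := by ring

end
end WaveletCommutator

/-! ### The frequency normalization, and real parameters from the extended norms -/

namespace WaveletCommutator
section
variable {n : ℕ}

/-- Under `λ = 1/t` one has `|dλ| = t⁻² dt`, hence `λ^(n-1) dλ` becomes `t^(-n-1) dt`. -/
theorem freqMeasure_eq_map (n : ℕ) : freqMeasure n = (scaleMeasure n).map (·⁻¹) := by
  have himg : (fun t : ℝ => t⁻¹) '' Set.Ioi 0 = Set.Ioi 0 := by
    ext t
    simp only [Set.mem_image, Set.mem_Ioi]
    exact ⟨fun ⟨s, hs, h⟩ => h ▸ inv_pos.2 hs, fun h => ⟨t⁻¹, inv_pos.2 h, inv_inv t⟩⟩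
  ext s hs
  rw [Measure.map_apply measurable_inv hs, ← lintegral_indicator_one (measurable_inv hs),
    lintegral_scaleMeasure, ← lintegral_indicator_one hs, freqMeasure,
    lintegral_withDensity_eq_lintegral_mul_non_measurable _ (by fun_prop)
    (Filter.Eventually.of_forall fun t => ENNReal.ofReal_lt_top)]
  conv_lhs => rw [← himg]
  rw [lintegral_image_eq_lintegral_abs_deriv_mul measurableSet_Ioi
    (fun t (ht : 0 < t) => (hasDerivAt_inv ht.ne').hasDerivWithinAt) inv_injective.injOn]
  refine setLIntegral_congr_fun measurableSet_Ioi fun t (ht : 0 < t) => ?_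
  have e : (s.indicator 1 t⁻¹ : ℝ≥0∞) = ((·⁻¹) ⁻¹' s).indicator 1 t := rfl
  simp only [Pi.mul_apply]
  rw [← mul_assoc, ← ENNReal.ofReal_mul (abs_nonneg _), e]
  congr 2
  rw [abs_neg, abs_of_pos (by positivity), Real.inv_rpow ht.le, ← Real.rpow_natCast,
    ← Real.rpow_neg ht.le, ← Real.rpow_neg ht.le, ← Real.rpow_add ht]
  congr 1
  push_cast
  ring

theorem freqDilation_inv (ψ : E n → ℂ) {t : ℝ} (ht : 0 < t) :
    freqDilation ψ t⁻¹ = scaleDilation ψ t := by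
  ext u
  rw [freqDilation, scaleDilation, Real.inv_rpow ht.le, Real.rpow_neg ht.le]

theorem commutator_freqDilation_inv (ψ : E n → ℂ) (τ : E n → E n) (f : E n → ℂ) (x : E n) {t : ℝ}
    (ht : 0 < t) :
    commutator (freqDilation ψ) τ f (x, t⁻¹) = commutator (scaleDilation ψ) τ f (x, t) := by
  simp only [commutator, deform, waveletTransform, freqDilation_inv ψ ht]

theorem ae_scaleMeasure_pos (n : ℕ) : ∀ᵐ t ∂(scaleMeasure n), 0 < t :=
  (withDensity_absolutelyContinuous _ _).ae_le (ae_restrict_mem measurableSet_Ioi)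

/-- The two normalizations correspond to each other under inversion of the dilation parameter. -/
theorem freq_of_scale {ψ : E n → ℂ} {τ : E n → E n} {f : E n → ℂ}
    (h : AEStronglyMeasurable (commutator (scaleDilation ψ) τ f)
      ((volume : Measure (E n)).prod (scaleMeasure n))) :
    AEStronglyMeasurable (commutator (freqDilation ψ) τ f)
      ((volume : Measure (E n)).prod (freqMeasure n)) ∧
    eLpNorm (commutator (freqDilation ψ) τ f) 2 ((volume : Measure (E n)).prod (freqMeasure n)) =
      eLpNorm (commutator (scaleDilation ψ) τ f) 2
        ((volume : Measure (E n)).prod (scaleMeasure n)) := by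
  set Φ : E n × ℝ → E n × ℝ := Prod.map id (·⁻¹) with hΦ
  have hΦe : MeasurableEmbedding Φ :=
    ((MeasurableEquiv.refl (E n)).prodCongr (MeasurableEquiv.inv ℝ)).measurableEmbedding
  have hmap : (volume : Measure (E n)).prod (freqMeasure n) =
      ((volume : Measure (E n)).prod (scaleMeasure n)).map Φ := by
    rw [freqMeasure_eq_map, hΦ, ← Measure.map_prod_map _ _ measurable_id measurable_inv,
      Measure.map_id]
  have hae : commutator (freqDilation ψ) τ f ∘ Φ =ᵐ[(volume : Measure (E n)).prod (scaleMeasure n)]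
      commutator (scaleDilation ψ) τ f := by
    filter_upwards [Measure.quasiMeasurePreserving_snd.ae (ae_scaleMeasure_pos n)] with p hp
    exact commutator_freqDilation_inv ψ τ f p.1 hp
  rw [hmap, hΦe.aestronglyMeasurable_map_iff, hΦe.eLpNorm_map_measure]
  exact ⟨h.congr hae.symm, eLpNorm_congr_ae hae⟩

/-- The set where the bound holds is closed by continuity and dense because its complement is null.
-/
theorem enorm_le_of_eLpNorm_top_le {f : E n → ℝ} (hf : Continuous f) {c : ℝ≥0∞}
    (h : eLpNorm f ∞ volume ≤ c) (x : E n) : ‖f x‖ₑ ≤ c := by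
  have hae : ∀ᵐ x, ‖f x‖ₑ ≤ c := by
    filter_upwards [ae_le_eLpNormEssSup (f := f) (μ := volume)] with x hx
    exact hx.trans (by rwa [eLpNorm_exponent_top] at h)
  have hcl : IsClosed {x | ‖f x‖ₑ ≤ c} := isClosed_le hf.enorm continuous_const
  exact hcl.closure_subset_iff.2 subset_rfl (Measure.dense_of_ae hae x)

theorem abs_le_toReal {f : E n → ℝ} (hf : Continuous f) {c : ℝ≥0∞} (hc : c ≠ ∞)
    (h : eLpNorm f ∞ volume ≤ c) (x : E n) : |f x| ≤ c.toReal := by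
  have := enorm_le_of_eLpNorm_top_le hf h x
  rwa [← ofReal_norm, ENNReal.ofReal_le_iff_le_toReal hc] at this

theorem isBoundedDeformation_of_norms (hn : 1 ≤ n) {τ : E n → E n} (hτ : ContDiff ℝ 2 τ)
    (h : normD τ ≤ ENNReal.ofReal (1 / (2 * (n : ℝ)))) (h2 : normD2 τ ≠ ∞) :
    IsBoundedDeformation τ (normD τ).toReal (normD2 τ).toReal := by
  have hn0 : (0 : ℝ) < n := by exact_mod_cast hn
  have hD : normD τ ≠ ∞ := (h.trans_lt ENNReal.ofReal_lt_top).ne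
  have hc1 : Continuous (fderiv ℝ τ) := hτ.continuous_fderiv (by norm_num)
  have hc2 : Continuous (fderiv ℝ (fderiv ℝ τ)) :=
    (hτ.fderiv_right (m := 1) (by norm_num)).continuous_fderiv (by norm_num)
  refine ⟨hτ, ENNReal.toReal_nonneg, ENNReal.toReal_nonneg, ?_, fun x i j => ?_,
    fun x i j k => ?_⟩
  · have := ENNReal.toReal_le_of_le_ofReal (by positivity) h
    calc (n : ℝ) * (normD τ).toReal ≤ n * (1 / (2 * n)) := by gcongr
      _ = 1 / 2 := by field_simp
  · refine abs_le_toReal (f := fun x => fderiv ℝ τ x (EuclideanSpace.single j 1) i) ?_ hD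
      (le_iSup₂_of_le i j le_rfl) x
    exact (EuclideanSpace.proj i : E n →L[ℝ] ℝ).continuous.comp (hc1.clm_apply continuous_const)
  · refine abs_le_toReal (f := fun x => fderiv ℝ (fderiv ℝ τ) x (EuclideanSpace.single k 1)
      (EuclideanSpace.single j 1) i) ?_ h2 (le_iSup₂_of_le i j (le_iSup_of_le k le_rfl)) x
    exact (EuclideanSpace.proj i : E n →L[ℝ] ℝ).continuous.comp
      ((hc2.clm_apply continuous_const).clm_apply continuous_const)

theorem norm_sub_le_of_normDelta {τ : E n → E n} (h : normDelta τ ≠ ∞) (x y : E n) :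
    ‖τ x - τ y‖ ≤ (normDelta τ).toReal := by
  rw [← ENNReal.ofReal_le_iff_le_toReal h, ofReal_norm]
  exact le_iSup₂_of_le x y le_rfl

/-- If the size of the deformation is finite, it is bounded below by `a L + b` for suitable real
parameters. -/
theorem exists_parameters (hn : 1 ≤ n) {τ : E n → E n} (hτ : ContDiff ℝ 2 τ)
    (h : normD τ ≤ ENNReal.ofReal (1 / (2 * (n : ℝ)))) (hs : deformationSize τ ≠ ∞) :
    ∃ a b D L : ℝ, IsBoundedDeformation τ a b ∧ (∀ x y, ‖τ x - τ y‖ ≤ D) ∧ 1 ≤ L ∧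
      Real.log (max 1 (D / (n * a))) ≤ L ∧ ENNReal.ofReal (a * L + b) ≤ deformationSize τ := by
  have hn1 : (1 : ℝ) ≤ n := by exact_mod_cast hn
  have h1 : normD τ ≠ ∞ := (h.trans_lt ENNReal.ofReal_lt_top).ne
  obtain ⟨hs1, hs2⟩ := ENNReal.add_ne_top.1 hs
  have hb := isBoundedDeformation_of_norms hn hτ h hs2
  have hbE : ENNReal.ofReal (normD2 τ).toReal = normD2 τ := ENNReal.ofReal_toReal hs2
  have haE : ENNReal.ofReal (normD τ).toReal = normD τ := ENNReal.ofReal_toReal h1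
  rcases eq_or_ne (normD τ) 0 with h0 | h0
  -- Here `τ` is constant, so `D = 0`, and the logarithm is `log 1 = 0`.
  · refine ⟨_, _, 0, 1, hb, fun x y => ?_, le_rfl, by simp, ?_⟩
    · simpa [h0] using hb.norm_sub_le x y
    · simp [h0, hbE, deformationSize]
  have ha : 0 < (normD τ).toReal := ENNReal.toReal_pos h0 h1
  -- As `normD τ` is nonzero, a finite product forces a finite logarithm, and therefore a finite
  -- oscillation of `τ`.
  have hlog : (ENNReal.log (normDelta τ / normD τ)).toENNReal ≠ ∞ := by
    intro htop
    rw [htop, max_eq_left le_top, ENNReal.mul_top h0] at hs1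
    exact hs1 rfl
  have hΔ : normDelta τ ≠ ∞ := by
    intro htop
    rw [htop, ENNReal.top_div_of_ne_top h1, ENNReal.log_top] at hlog
    simp at hlog
  set a := (normD τ).toReal with ha'
  set D := (normDelta τ).toReal with hD'
  have hD0 : 0 ≤ D := ENNReal.toReal_nonneg
  refine ⟨a, _, D, max (Real.log (D / a)) 1, hb, norm_sub_le_of_normDelta hΔ, le_max_right _ _,
    ?_, ?_⟩
  · rcases le_or_gt (D / (n * a)) 1 with h3 | h3
    · rw [max_eq_left h3, Real.log_one]
      exact zero_le_one.trans (le_max_right _ _)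
    · rw [max_eq_right h3.le]
      refine le_trans (Real.log_le_log (by linarith) ?_) (le_max_left _ _)
      gcongr
      nlinarith
  · rw [ENNReal.ofReal_add (by positivity) ENNReal.toReal_nonneg, hbE, deformationSize,
      ENNReal.ofReal_mul ha.le, haE]
    gcongr
    -- For `D = 0` the real logarithm takes the default value `log 0 = 0`, and the maximum with `1`
    -- hides it.
    rcases hD0.eq_or_lt with h3 | h3
    · rw [← h3]
      simp
    · have e : normDelta τ / normD τ = ENNReal.ofReal (D / a) := by
        rw [ENNReal.ofReal_div_of_pos ha, haE, ENNReal.ofReal_toReal hΔ]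
      rw [e, ENNReal.log_ofReal_of_pos (by positivity), EReal.toENNReal_of_ne_top (by simp),
        EReal.toReal_coe]
      rw [ENNReal.ofReal_mono.map_max, ENNReal.ofReal_one]

/-- When `A = 0` and the deformation has infinite size, the right-hand side of the main estimate is
`0 * ∞ = 0`, so the estimate is not vacuous; it holds because `ψ` vanishes. -/
theorem IsDecayingWavelet.commutator_eq_zero {ψ : E n → ℂ} (h : IsDecayingWavelet ψ 0)
    (τ : E n → E n) (f : E n → ℂ) : commutator (scaleDilation ψ) τ f = 0 := by
  have hψ : ψ = 0 := by
    ext x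
    simpa using h.norm_le x
  have hd : ∀ t, scaleDilation ψ t = 0 := fun t => by
    ext x
    simp [scaleDilation, hψ]
  ext p
  simp [commutator, waveletTransform, deform, hd]

end
end WaveletCommutator

theorem mainTheorem3 (n : ℕ) (hn : 1 ≤ n) :
    ∃ C : ℝ, 0 < C ∧
      ∀ (ψ : WaveletCommutator.E n → ℂ) (A : ℝ), WaveletCommutator.IsDecayingWavelet ψ A →
        ∀ τ : WaveletCommutator.E n → WaveletCommutator.E n, ContDiff ℝ 2 τ →
          WaveletCommutator.normD τ ≤ ENNReal.ofReal (1 / (2 * (n : ℝ))) →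
            WaveletCommutator.freqCommutatorNorm ψ τ ≤
                ENNReal.ofReal (C * A) * WaveletCommutator.deformationSize τ ∧
              WaveletCommutator.scaleCommutatorNorm ψ τ ≤
                ENNReal.ofReal (C * A) * WaveletCommutator.deformationSize τ := by
  obtain ⟨C, hC, hbound⟩ := WaveletCommutator.exists_eLpNorm_commutator_le n hn
  refine ⟨C, hC, fun ψ A hψ τ hτ hsmall => ?_⟩
  suffices key : ∀ f : WaveletCommutator.E n → ℂ, MemLp f 2 volume →
      ENNReal.ofReal (C * A) * WaveletCommutator.deformationSize τ ≠ ∞ →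
      AEStronglyMeasurable
        (WaveletCommutator.commutator (WaveletCommutator.scaleDilation ψ) τ f)
        (volume.prod (WaveletCommutator.scaleMeasure n)) ∧
      eLpNorm (WaveletCommutator.commutator (WaveletCommutator.scaleDilation ψ) τ f) 2
          (volume.prod (WaveletCommutator.scaleMeasure n)) ≤
        ENNReal.ofReal (C * A) * WaveletCommutator.deformationSize τ * eLpNorm f 2 volume by
    rcases eq_or_ne (ENNReal.ofReal (C * A) * WaveletCommutator.deformationSize τ) ∞ with
      htop | htop
    · rw [htop]
      exact ⟨le_top, le_top⟩
    refine ⟨sInf_le fun f hf => ?_, sInf_le fun f hf => key f hf htop⟩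
    obtain ⟨h1, h2⟩ := key f hf htop
    obtain ⟨h3, h4⟩ := WaveletCommutator.freq_of_scale h1
    exact ⟨h3, h4.trans_le h2⟩
  intro f hf htop
  rcases hψ.nonneg.eq_or_lt with rfl | hA
  · rw [hψ.commutator_eq_zero]
    exact ⟨aestronglyMeasurable_zero, by simp⟩
  have hCA : ENNReal.ofReal (C * A) ≠ 0 := by
    rw [ne_eq, ENNReal.ofReal_eq_zero, not_le]
    positivity
  -- With `A > 0`, a finite right-hand side forces a finite deformation size, so real parameters
  -- exist.
  have hs : WaveletCommutator.deformationSize τ ≠ ∞ := fun h => by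
    rw [h, ENNReal.mul_top hCA] at htop
    exact htop rfl
  obtain ⟨a, b, D, L, hab, hD, hL, hlog, hle⟩ :=
    WaveletCommutator.exists_parameters hn hτ hsmall hs
  obtain ⟨h1, h2⟩ := hbound ψ A hψ τ a b D L hab hD hL hlog f hf
  refine ⟨h1, h2.trans ?_⟩
  rw [ENNReal.ofReal_mul (by positivity)]
  gcongr
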